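/- Let $G$ be a finite set and $p:G\times G^{-\mathbf N_+}\to[0,1]$ a kernel: $p(g|\cdot)$ is measurable on the set of histories $\mathbf w=(w_{-1},w_{-2},\dots)$ and $\sum_{g}p(g|\mathbf w)=1$. *Admissible histories.* A letter $g$ is forbidden if $p(g|\mathbf w)=0$ for all $\mathbf w$; a word $(s_0,s_{-1},\dots,s_{-n})$ is forbidden if $(s_{-1},\dots,s_{-n})$ is forbidden or $p(s_0|\mathbf w)=0$ for all histories $\mathbf w$ that begin with $(s_{-1},\dots,s_{-n})$. Let $\mathcal H$ be the set of histories none of whose words $(w_{-1},\dots,w_{-n})$ is forbidden. *Coefficients.* For $\mathbf w\in\mathcal H$, $k\ge 0$, put $a_k(g|\mathbf w)=\inf\{p(g|\mathbf z):\mathbf z\in\mathcal H,\ z_{-i}=w_{-i}\ (1\le i\le k)\}$, $a_k(\mathbf w)=\sum_g a_k(g|\mathbf w)$, $a_k=\inf_{\mathbf w\in\mathcal H}a_k(\mathbf w)$, $a_{-1}\equiv 0$ and $b_k(g|\mathbf w)=a_k(g|\mathbf w)-a_{k-1}(g|\mathbf w)$. Both $a_k(g|\mathbf w)$ and $a_k(\mathbf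 w)$ depend on $w_{-1},\dots,w_{-k}$ only; write $a_1(g|w)$, $a_1(w)$ for $k=1$, $w_{-1}=w$. *Coupling functions.* A maximal coupling function is an $f:[0,1)\times\mathcal H\to G$ obtained by partitioning each $[a_{k-1}(\mathbf w),a_k(\mathbf w))$, $k\ge 0$, into intervals $B_k(g|\mathbf w)=[c,c+b_k(g|\mathbf w))$, $g\in G$, depending on $w_{-1},\dots,w_{-k}$ only, and setting $f(u|\mathbf w)=g$ for $u\in B_k(g|\mathbf w)$. A rearrangement of $f$ is a function $\bar f:[0,1)\times\mathcal H\to G$ with $\bar f(u|\mathbf w)=f(u|\mathbf w)$ for $u\ge a_1(w_{-1})$ such that, for each $h\in G$, $\{u<a_1(w_{-1}):\bar f(u|\mathbf w)=h\}$ is the union of two disjoint (possibly empty) intervals $B^1(h|w_{-1})$, $B^2(h|w_{-1})$ of the form $[c,d)$, depending on $h$ and $w_{-1}$ only, of total length $a_1(h|w_{-1})$, where $B^1(h|w_{-1})$ meets $[0,a_1)$ if $a_1(h|w_{-1})>0$. The modified coupling function $\hat f:[0,1)^{|G|+1}\times\mathcal H\to G$, in which trajectories move independently in the Markov regime $u^0<a_1$,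 is $$\hat f(u^0;u^g,g\in G|\mathbf w)=\bar f(u^0|\mathbf w)\ \text{ if }u^0\ge a_1,\qquad \hat f(u^0;u^g,g\in G|\mathbf w)=\bar f(a_1u^{w_{-1}}|\mathbf w)\ \text{ if }u^0<a_1 .$$ Put $\hat f^{(1)}=\hat f$ and $\hat f^{(n+1)}(u_n,\dots,u_0|\mathbf w)=\hat f(u_n|\hat f^{(n)}(u_{n-1},\dots,u_0|\mathbf w),\dots,\hat f^{(1)}(u_0|\mathbf w),\mathbf w)$. *Graphs.* Let $\mathcal G$ be the oriented graph on $G$ with set of arcs $\mathcal A=\{(w,g): w=z_{-1}\text{ for some }\mathbf z\in\mathcal H,\ a_1(g|w)>0\}$. An irreducible class of an oriented graph is a non-empty set of vertices which no arc leaves and in which every vertex is joined to every vertex (itself included) by a path of positive length; it is aperiodic if the lengths of the closed paths through each of its vertices have greatest common divisor $1$. **Theorem.** Assume that (i) $\sum_{n=1}^\infty\prod_{m=1}^n a_m=\infty$; (ii) $\mathcal G$ has exactly one irreducible class, and this class is aperiodic; (iii) for every $g\in G$ there is $w\in G$ with $(w,g)\notin\mathcal A$. Then functions $f$ and $\bar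 f$ as above exist, and for every such choice $\hat f$ is a coupling function for $p$ (for $U$ uniform on $[0,1)^{|G|+1}$ and $\mathbf w\in\mathcal H$, $P(\hat f(U|\mathbf w)=g)=p(g|\mathbf w)$) which has a backward coalescence time: for $(U_i)_{i\in\mathbf Z}$ i.i.d. uniform on $[0,1)^{|G|+1}$ there is a function $\tau_0\le 0$ of $(U_0,U_{-1},\dots)$ such that $-\tau_0$ is an a.s. finite stopping time for the filtration $\sigma(U_0,\dots,U_{-n})$, $n\ge 0$, and $\tau_0=-l$ implies $\hat f^{(l+1)}(U_0,\dots,U_{-l}|\mathbf w)=\hat f^{(l+1)}(U_0,\dots,U_{-l}|\mathbf z)$ for all $\mathbf w,\mathbf z\in\mathcal H$. Moreover $\tau_0$ gives perfect simulation: for each $\mathbf g\in\mathcal H$ the process $X_n=\hat f^{(l+1)}(U_n,\dots,U_{n-l}|\mathbf g)$, where $-l=\tau_0(U_n,U_{n-1},\dots)$, $n\in\mathbf Z$, is stationary, and its law is the unique law of a process compatible with $p$, i.e. such that $P(X_m=g|X_{m-i},i\ge 1)=p(g|X_{m-1},X_{m-2},\dots)$ a.s. for all $m\in\mathbf Z$,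 $g\in G$. The same conclusions hold if, for some oriented graph $(G,\mathcal A)$ on which $p$ is the kernel of a generalized random walk, (i) holds and (ii), (iii) hold for $(G,\mathcal A)$. Here $p$ is the kernel of a generalized random walk on $(G,\mathcal A)$ if for all $w,g\in G$: when $(w,g)\notin\mathcal A$, $p(g|\mathbf z)=0$ for all histories with $z_{-1}=w$; when $(w,g)\in\mathcal A$, there is $\epsilon>0$ with $p(g|\mathbf z)>\epsilon$ for all histories with $z_{-1}=w$ and $(z_{-(k+1)},z_{-k})\in\mathcal A$ for all $k\ge 1$. -/

import Mathlib

open MeasureTheory Set Filter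
open scoped ProbabilityTheory

namespace PerfectSim

noncomputable section

/-! ### Histories, kernels, admissible histories -/

/-- A history `(w₋₁, w₋₂, …)`; the letter `w₋₍ᵢ₊₁₎` is stored at index `i`. -/
abbrev Hist (G : Type*) := ℕ → G

/-- `(g, w₋₁, w₋₂, …)`: the history `w` prolonged by the new most recent letter `g`. -/
def snoc {G : Type*} (g : G) (w : Hist G) : Hist G
  | 0 => g
  | i + 1 => w i

/-- The word `(w₋₁, …, w₋ₖ)`, most recent letter first. -/
def word {G : Type*} (w : Hist G) (k : ℕ) : List G := (List.range k).map w

/-- `p g w` is the probability `p(g | w)` of the letter `g` after the history `w`. -/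
structure IsTransitionKernel {G : Type*} [Fintype G] [MeasurableSpace G]
    (p : G → Hist G → ℝ) : Prop where
  measurable : ∀ g, Measurable (p g)
  nonneg : ∀ g w, 0 ≤ p g w
  sum_eq_one : ∀ w, ∑ g, p g w = 1

/-- Forbidden words, by recursion on the length; the most recent letter is the head of the list. -/
def Forbidden {G : Type*} (p : G → Hist G → ℝ) : List G → Prop
  | [] => False
  | s :: t => Forbidden p t ∨ ∀ w : Hist G, word w t.length = t → p s w = 0

/-- The set `ℋ` of admissible histories. -/
def admissible {G : Type*} (p : G → Hist G → ℝ) : Set (Hist G) :=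
  {w | ∀ n, ¬ Forbidden p (word w n)}

/-! ### The quantities `aₖ` and maximal coupling functions -/

/-- `aₖ(g | w₋₁, …, w₋ₖ)`, the infimum of `p(g | z)` over the admissible histories `z` whose last
`k` letters agree with those of `w`. It is used for admissible `w` only. -/
def aLetter {G : Type*} (p : G → Hist G → ℝ) (k : ℕ) (g : G) (w : Hist G) : ℝ :=
  sInf (p g '' {z | z ∈ admissible p ∧ word z k = word w k})

/-- `aₖ(w₋₁, …, w₋ₖ) = ∑_g aₖ(g | w₋₁, …, w₋ₖ)`. -/
def aSum {G : Type*} [Fintype G] (p : G → Hist G → ℝ) (k : ℕ) (w : Hist G) : ℝ :=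
  ∑ g, aLetter p k g w

/-- `aₖ`, the infimum of `aₖ(w₋₁, …, w₋ₖ)` over the admissible histories. -/
def aMin {G : Type*} [Fintype G] (p : G → Hist G → ℝ) (k : ℕ) : ℝ :=
  sInf (aSum p k '' admissible p)

/-- The increment `bₖ(g | w) = aₖ(g | w) - aₖ₋₁(g | w)`, with `a₋₁ = 0`. -/
def bLetter {G : Type*} (p : G → Hist G → ℝ) : ℕ → G → Hist G → ℝ
  | 0, g, w => aLetter p 0 g w
  | k + 1, g, w => aLetter p (k + 1) g w - aLetter p k g w

/-- `aₖ₋₁(w)`, with `a₋₁ = 0`. -/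
def aSumPrev {G : Type*} [Fintype G] (p : G → Hist G → ℝ) : ℕ → Hist G → ℝ
  | 0, _ => 0
  | k + 1, w => aSum p k w

/-- `f` (used on `[0,1) × ℋ`) is a maximal coupling function: each interval
`[aₖ₋₁(w), aₖ(w))` is partitioned into intervals `Bₖ(g | w₋₁, …, w₋ₖ)` of length `bₖ(g | w)`,
`g ∈ G`, the left endpoints depending on the last `k` letters of `w` only, and `f(· | w) = g` on
`Bₖ(g | w₋₁, …, w₋ₖ)`. -/
def IsMaximalCoupling {G : Type*} [Fintype G] (p : G → Hist G → ℝ)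
    (f : ℝ → Hist G → G) : Prop :=
  ∃ c : ℕ → G → List G → ℝ, ∀ w ∈ admissible p, ∀ k,
    (∀ g, Ico (c k g (word w k)) (c k g (word w k) + bLetter p k g w) ⊆
      Ico (aSumPrev p k w) (aSum p k w)) ∧
    ∀ u ∈ Ico (aSumPrev p k w) (aSum p k w), ∀ g,
      f u w = g ↔ u ∈ Ico (c k g (word w k)) (c k g (word w k) + bLetter p k g w)

/-- `fbar` is a rearrangement of the maximal coupling function `f`: the two agree for
`u ≥ a₁(w₋₁)`, and below `a₁(w₋₁)` the function `fbar(· | w)` takes the value `h` on the union of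
two disjoint intervals `[c₁, d₁)` and `[c₂, d₂)`, depending on `h` and `w₋₁` only, of total length
`a₁(h | w₋₁)`, the first of which meets `[0, a₁)` when `a₁(h | w₋₁) > 0`. -/
def IsRearrangement {G : Type*} [Fintype G] (p : G → Hist G → ℝ)
    (f fbar : ℝ → Hist G → G) : Prop :=
  ∃ c₁ d₁ c₂ d₂ : G → G → ℝ, ∀ w ∈ admissible p,
    (∀ h, c₁ h (w 0) ≤ d₁ h (w 0) ∧ c₂ h (w 0) ≤ d₂ h (w 0) ∧
      Ico (c₁ h (w 0)) (d₁ h (w 0)) ∪ Ico (c₂ h (w 0)) (d₂ h (w 0)) ⊆ Ico 0 (aSum p 1 w) ∧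
      Disjoint (Ico (c₁ h (w 0)) (d₁ h (w 0))) (Ico (c₂ h (w 0)) (d₂ h (w 0))) ∧
      (d₁ h (w 0) - c₁ h (w 0)) + (d₂ h (w 0) - c₂ h (w 0)) = aLetter p 1 h w ∧
      (0 < aLetter p 1 h w →
        (Ico (c₁ h (w 0)) (d₁ h (w 0)) ∩ Ico 0 (aMin p 1)).Nonempty)) ∧
    (∀ u ∈ Ico 0 (aSum p 1 w), ∀ h,
      fbar u w = h ↔
        u ∈ Ico (c₁ h (w 0)) (d₁ h (w 0)) ∪ Ico (c₂ h (w 0)) (d₂ h (w 0))) ∧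
    ∀ u ∈ Ico (aSum p 1 w) 1, fbar u w = f u w

/-! ### The source of randomness and the coupling function with independent trajectories -/

/-- The interval `[0,1)`. -/
abbrev I01 := ↥(Ico (0 : ℝ) 1)

/-- Lebesgue measure on `[0,1)`. -/
def unif01 : Measure I01 := Measure.comap Subtype.val (volume : Measure ℝ)

/-- The cube `[0,1)^{|G|+1}`; a point is `(u⁰; u^g, g ∈ G)`. -/
abbrev Cube (G : Type*) := I01 × (G → I01)

/-- Lebesgue measure on `[0,1)^{|G|+1}`. -/
def cubeLaw (G : Type*) [Fintype G] : Measure (Cube G) :=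
  unif01.prod (Measure.pi fun _ => unif01)

instance instProbUnif : IsProbabilityMeasure unif01 := by
  constructor
  rw [unif01, comap_subtype_coe_apply measurableSet_Ico, image_univ, Subtype.range_coe,
    Real.volume_Ico]
  simp

instance instProbCube (G : Type*) [Fintype G] : IsProbabilityMeasure (cubeLaw G) := by
  unfold cubeLaw
  infer_instance

/-- The law of an i.i.d. sequence of uniform points of the cube indexed by `ι`. -/
def iidLaw (G : Type*) [Fintype G] (ι : Type*) : Measure (ι → Cube G) :=
  Measure.infinitePi fun _ => cubeLaw G

instance instProbIid (G : Type*) [Fintype G] (ι : Type*) : IsProbabilityMeasure (iidLaw G ι) := by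
  unfold iidLaw
  infer_instance

/-- The modified coupling function: in the Markov regime `u⁰ < a₁`, trajectories in different
states use different coordinates `u^g`. -/
def fhat {G : Type*} [Fintype G] (p : G → Hist G → ℝ) (fbar : ℝ → Hist G → G)
    (v : Cube G) (w : Hist G) : G :=
  open Classical in
  if (v.1 : ℝ) < aMin p 1 then fbar (aMin p 1 * (v.2 (w 0) : ℝ)) w else fbar (v.1 : ℝ) w

/-- `F : [0,1)^{|G|+1} × ℋ → G` reproduces the kernel `p`. -/
def Reproduces {G : Type*} [Fintype G] (p : G → Hist G → ℝ) (F : Cube G → Hist G → G) : Prop :=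
  ∀ w ∈ admissible p, ∀ g, MeasurableSet {v | F v w = g} ∧
    cubeLaw G {v | F v w = g} = ENNReal.ofReal (p g w)

/-- Sequences `u : ℕ → Cube G` are read backward in time, `u i = U₋ᵢ`. `traj F u n w` is the
history `(x₀, x₋₁, …)` at time `0` obtained by starting from the history `w` before time
`-n + 1` and applying `F` successively with `U₋ₙ₊₁, …, U₋₁, U₀`. In particular
`traj F u (l + 1) w 0 = F^{(l+1)}(U₀, …, U₋ₗ | w)`. -/
def traj {G : Type*} (F : Cube G → Hist G → G) (u : ℕ → Cube G) : ℕ → Hist G → Hist G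
  | 0, w => w
  | n + 1, w => traj F u n (snoc (F (u n) w) w)

/-- `τ` is the negative of a backward coalescence time for `F`: an a.s. finite stopping time
for the filtration of `U₀, U₋₁, …` such that `τ = l` makes the state at time `0` independent of the
admissible history before time `-l`. -/
structure IsBackwardCoalescenceTime {G : Type*} [Fintype G] (p : G → Hist G → ℝ)
    (F : Cube G → Hist G → G) (τ : (ℕ → Cube G) → WithTop ℕ) : Prop where
  stopping : IsStoppingTime (Filtration.piLE (X := fun _ : ℕ => Cube G)) τ
  finite : ∀ᵐ u ∂(iidLaw G ℕ), τ u ≠ ⊤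
  coalescence : ∀ u, ∀ l : ℕ, τ u = (l : WithTop ℕ) →
    ∀ w ∈ admissible p, ∀ z ∈ admissible p, traj F u (l + 1) w 0 = traj F u (l + 1) z 0

/-! ### Compatible processes and the simulated process -/

/-- `(xₘ₋₁, xₘ₋₂, …)`. -/
def past {G : Type*} (m : ℤ) (x : ℤ → G) : Hist G := fun i => x (m - 1 - i)

/-- `μ` is the law of a process indexed by `ℤ` which is compatible with `p`. -/
structure IsCompatible {G : Type*} [MeasurableSpace G] (p : G → Hist G → ℝ)
    (μ : Measure (ℤ → G)) : Prop where
  prob : IsProbabilityMeasure μ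
  condProb : ∀ (m : ℤ) (g : G),
    μ⟦{x : ℤ → G | x m = g} | MeasurableSpace.comap (past m) inferInstance⟧
      =ᵐ[μ] fun x => p g (past m x)

/-- `μ` is invariant under the shift of `ℤ`. -/
def IsStationaryLaw {G : Type*} [MeasurableSpace G] (μ : Measure (ℤ → G)) : Prop :=
  μ.map (fun x n => x (n + 1)) = μ

/-- The simulated process: `Xₙ = F^{(l+1)}(Uₙ, …, Uₙ₋ₗ | g₀)` when the backward coalescence time of
time `n`, computed from `Uₙ, Uₙ₋₁, …`, is `n - l` (on the null event that it is infinite, `l = 0` is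
used); `g₀` is a reference history. -/
def simulated {G : Type*} (F : Cube G → Hist G → G) (τ : (ℕ → Cube G) → WithTop ℕ)
    (g₀ : Hist G) (u : ℤ → Cube G) (n : ℤ) : G :=
  let back : ℕ → Cube G := fun i => u (n - i)
  traj F back ((τ back).untopD 0 + 1) g₀ 0

/-! ### Graphs -/

/-- The arcs `(w, g)` of the oriented graph of `p`: `a₁(g | w) > 0`, where `a₁(g | w)` is computed
from any admissible history with last letter `w` (so `w` must occur as such a letter). -/
def arc {G : Type*} (p : G → Hist G → ℝ) (w g : G) : Prop :=
  ∃ z ∈ admissible p, z 0 = w ∧ 0 < aLetter p 1 g z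

/-- There is an oriented path with exactly `n` arcs. -/
def ReachIn {G : Type*} (A : G → G → Prop) : ℕ → G → G → Prop
  | 0, x, y => x = y
  | n + 1, x, y => ∃ z, A x z ∧ ReachIn A n z y

/-- Irreducible classes: non-empty sets of vertices which no arc leaves and in which any vertex is
joined to any vertex (itself included) by a path of positive length. -/
def IsIrreducibleClass {G : Type*} (A : G → G → Prop) (C : Set G) : Prop :=
  C.Nonempty ∧ (∀ x ∈ C, ∀ y, A x y → y ∈ C) ∧ ∀ x ∈ C, ∀ y ∈ C, ∃ n, 0 < n ∧ ReachIn A n x y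

/-- The lengths of the closed paths through any vertex of `C` have greatest common divisor `1`. -/
def IsAperiodic {G : Type*} (A : G → G → Prop) (C : Set G) : Prop :=
  ∀ x ∈ C, ∀ d : ℕ, (∀ n, 0 < n → ReachIn A n x x → d ∣ n) → d = 1

/-- The histories that are infinite backward paths of the graph. -/
def backwardPaths {G : Type*} (A : G → G → Prop) : Set (Hist G) :=
  {w | ∀ k, A (w (k + 1)) (w k)}

/-- `p` is the kernel of a generalized random walk on the graph with arcs `A`. -/
structure IsGeneralizedRandomWalk {G : Type*} (p : G → Hist G → ℝ) (A : G → G → Prop) :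
    Prop where
  eq_zero : ∀ w g, ¬ A w g → ∀ z : Hist G, z 0 = w → p g z = 0
  lower_bound : ∀ w g, A w g → ∃ ε > 0, ∀ z ∈ backwardPaths A, z 0 = w → ε < p g z

end

end PerfectSim

open PerfectSim

/-!
The proof rests on a coalescence argument for the flow of maps generated by `fhat`.

Divergence of `∑ ∏ aₘ` forces `aₖ` to approach `1` and `a₁ > 0` (`exists_lt_aMin`, `aMin_one_pos`);
hence `aₖ(g | w)` increases to `p(g | w)`, every level `u < 1` lies below some `aₖ`, and the modified
coupling function reproduces the kernel. What is used of it afterwards is recorded in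
`IsLocalCoupling`: below the level `aₖ` it reads the last `k` letters only, and below `a₁` the letters
`x` are moved independently, each along any prescribed arc with positive probability.

*A coalescing block.* As the only irreducible class is aperiodic, some vertex `z` is reached from all
letters of admissible histories by paths of one common length `N` (`exists_uniform_reachIn`). If each
letter joined to `z` by a path of length `j + 1` is moved, `j` steps before the end, to one joined to
`z` by a path of length `j`, then all of them arrive in `z` after `N` steps; hence `N` successive variables merge all trajectories with some probability `δ > 0`
(`IsLocalCoupling.exists_block`).

*The coalescence time.* Call `s` good if a coalescing block ends at time `-s` and each later variable
`U₋ₜ` lies below `aₛ₋ₜ`: these variables read only letters produced since time `-s`, so the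
trajectories stay merged up to time `0`. Let `c` be the probability that there is no good `s`. The
event that `s` is good while the variables preceding its block admit no good time has probability
`(∏_{m ≤ s} aₘ) δ c`, by independence, and at most `N` of these events occur simultaneously. Summing
over `s` yields `δ c ∑ₛ ∏_{m ≤ s} aₘ ≤ N`, so that `c = 0` (`ae_exists_goodAt`).

*Perfect simulation.* A trajectory started far enough in the past passes through any given number of
the simulated states, whence `Xₘ = fhat(Uₘ | Xₘ₋₁, Xₘ₋₂, …)` almost surely
(`IsBackwardCoalescenceTime.simState_eq`); compatibility follows from the independence of `Uₘ` and the
simulated past. Conversely, a compatible process has the law of a trajectory of `fhat` started from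
its own past, which is almost surely admissible. Letting the starting time tend to `-∞`, coalescence
identifies its finite-dimensional laws with those of the simulated process
(`IsCompatible.measure_past_le`).
-/

namespace PerfectSim

/-! ### Words and admissible histories -/

section Words

variable {G : Type*}

theorem word_length (w : Hist G) (k : ℕ) : (word w k).length = k := by simp [word]

theorem word_eq_word_iff {w z : Hist G} {k : ℕ} :
    word w k = word z k ↔ ∀ i < k, w i = z i := by
  simp [word]

theorem word_eq_of_le {w z : Hist G} {j k : ℕ} (hjk : j ≤ k) (h : word w k = word z k) :
    word w j = word z j :=
  word_eq_word_iff.2 fun i hi => word_eq_word_iff.1 h i (hi.trans_le hjk)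

theorem word_one_eq_iff {w z : Hist G} : word w 1 = word z 1 ↔ w 0 = z 0 := by
  simp [word]

@[simp] theorem snoc_zero (g : G) (w : Hist G) : snoc g w 0 = g := rfl

@[simp] theorem snoc_succ (g : G) (w : Hist G) (i : ℕ) : snoc g w (i + 1) = w i := rfl

theorem snoc_head_tail (w : Hist G) : snoc (w 0) (fun i => w (i + 1)) = w := by
  funext i
  cases i <;> rfl

theorem word_snoc (g : G) (w : Hist G) (k : ℕ) : word (snoc g w) (k + 1) = g :: word w k := by
  simp [word, List.range_succ_eq_map, Function.comp_def]

theorem word_succ (w : Hist G) (k : ℕ) : word w (k + 1) = w 0 :: word (fun i => w (i + 1)) k := by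
  rw [← word_snoc, snoc_head_tail]

theorem word_append_drop (w : Hist G) {j k : ℕ} (h : j ≤ k) :
    word w k = word w j ++ (word w k).drop j := by
  have : word w j = (word w k).take j := by
    simp [word, ← List.map_take, List.take_range, min_eq_left h]
  rw [this, List.take_append_drop]

end Words

section Admissible

variable {G : Type*} {p : G → Hist G → ℝ}

theorem Forbidden.append {l : List G} (h : Forbidden p l) (l' : List G) :
    Forbidden p (l ++ l') := by
  induction l with
  | nil => exact h.elim
  | cons s t ih =>
    rcases h with h | h
    · exact Or.inl (ih h)
    · refine Or.inr fun w hw => h w ?_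
      have h1 := word_append_drop w (j := t.length) (k := (t ++ l').length) (by simp)
      rw [show word w (t ++ l').length = t ++ l' from hw] at h1
      exact (List.append_inj h1.symm (word_length _ _)).1

theorem Forbidden.mono {w : Hist G} {j k : ℕ} (hjk : j ≤ k) (h : Forbidden p (word w j)) :
    Forbidden p (word w k) := by
  rw [word_append_drop w hjk]
  exact h.append _

theorem snoc_mem_admissible {w : Hist G} {g : G} (hw : w ∈ admissible p) (hg : p g w ≠ 0) :
    snoc g w ∈ admissible p := by
  rintro (_ | n)
  · exact id
  · rw [word_snoc]
    rintro (h | h)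
    · exact hw n h
    · exact hg (h w (by rw [word_length]))

theorem tail_mem_admissible {w : Hist G} (hw : w ∈ admissible p) :
    (fun i => w (i + 1)) ∈ admissible p := fun n h => hw (n + 1) (by
  rw [word_succ]
  exact Or.inl h)

theorem exists_ne_zero_of_mem_admissible {w : Hist G} (hw : w ∈ admissible p) (k : ℕ) :
    ∃ z : Hist G, z 0 = w (k + 1) ∧ p (w k) z ≠ 0 := by
  have hk : (fun i => w (i + k)) ∈ admissible p := by
    induction k with
    | zero => exact hw
    | succ k ih => convert tail_mem_admissible ih using 3 with i; ring
  have h2 := hk 2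
  rw [word_succ] at h2
  by_contra! hcon
  refine h2 (Or.inr fun z hz => ?_)
  rw [word_length, word_one_eq_iff] at hz
  simpa using hcon z (by simpa [add_comm] using hz)

theorem exists_pos_letter [Fintype G] [MeasurableSpace G] (hp : IsTransitionKernel p)
    (w : Hist G) : ∃ g, p g w ≠ 0 := by
  by_contra! h
  simpa [h] using hp.sum_eq_one w

/-- Every finite non-forbidden word can be continued, so compactness of `G^ℕ` yields an
admissible history. -/
theorem admissible_nonempty [Fintype G] [MeasurableSpace G] [Nonempty G]
    (hp : IsTransitionKernel p) : (admissible p).Nonempty := by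
  let _ : TopologicalSpace G := ⊥
  have : DiscreteTopology G := ⟨rfl⟩
  have hcl : ∀ n, IsClosed {w : Hist G | ¬ Forbidden p (word w n)} := by
    intro n
    rw [← isOpen_compl_iff, isOpen_iff_mem_nhds]
    intro w hw
    have h1 : {z : Hist G | ∀ i ∈ Finset.range n, z i = w i} ∈ nhds w := by
      have := set_pi_mem_nhds (Finset.range n).finite_toSet (x := w) (s := fun i => {w i})
        (fun i _ => by simp)
      convert this using 1
      ext z
      simp
    filter_upwards [h1] with z hz
    have : word z n = word w n := word_eq_word_iff.2 fun i hi => hz i (Finset.mem_range.2 hi)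
    simpa [this] using hw
  have hne : ∀ n, {w : Hist G | ¬ Forbidden p (word w n)}.Nonempty := by
    intro n
    induction n with
    | zero => exact ⟨fun _ => Classical.arbitrary G, id⟩
    | succ n ih =>
      obtain ⟨w, hw⟩ := ih
      obtain ⟨g, hg⟩ := exists_pos_letter hp w
      refine ⟨snoc g w, ?_⟩
      rw [mem_ofPred_eq, word_snoc]
      rintro (h | h)
      · exact hw h
      · exact hg (h w (by rw [word_length]))
  have := IsCompact.nonempty_iInter_of_sequence_nonempty_isCompact_isClosed
    (fun n => {w : Hist G | ¬ Forbidden p (word w n)})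
    (fun n w hw h => hw (h.mono n.le_succ)) hne (hcl 0).isCompact hcl
  obtain ⟨w, hw⟩ := this
  exact ⟨w, fun n => mem_iInter.1 hw n⟩

end Admissible

/-! ### The coefficients `aₖ` -/

section Coefficients

variable {G : Type*} {p : G → Hist G → ℝ}

theorem aLetter_congr {k : ℕ} {w z : Hist G} (h : word w k = word z k) (g : G) :
    aLetter p k g w = aLetter p k g z := by
  simp [aLetter, h]

theorem bLetter_congr {k : ℕ} {w z : Hist G} (h : word w k = word z k) (g : G) :
    bLetter p k g w = bLetter p k g z := by
  cases k with
  | zero => exact aLetter_congr h g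
  | succ k =>
    simp only [bLetter, aLetter_congr h g, aLetter_congr (word_eq_of_le k.le_succ h) g]

variable [Fintype G]

theorem aSum_congr {k : ℕ} {w z : Hist G} (h : word w k = word z k) :
    aSum p k w = aSum p k z := by
  simp [aSum, aLetter_congr h]

theorem aSumPrev_congr {k : ℕ} {w z : Hist G} (h : word w k = word z k) :
    aSumPrev p k w = aSumPrev p k z := by
  cases k with
  | zero => rfl
  | succ k => exact aSum_congr (word_eq_of_le k.le_succ h)

theorem sum_bLetter (k : ℕ) (w : Hist G) :
    ∑ g, bLetter p k g w = aSum p k w - aSumPrev p k w := by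
  cases k with
  | zero => simp [bLetter, aSum, aSumPrev]
  | succ k => simp [bLetter, aSum, aSumPrev]

variable [MeasurableSpace G]

theorem aLetter_nonneg (hp : IsTransitionKernel p) (k : ℕ) (g : G) (w : Hist G) :
    0 ≤ aLetter p k g w := by
  refine Real.sInf_nonneg ?_
  rintro _ ⟨z, -, rfl⟩
  exact hp.nonneg g z

theorem bddBelow_image (hp : IsTransitionKernel p) (g : G) (S : Set (Hist G)) :
    BddBelow (p g '' S) := ⟨0, by
  rintro _ ⟨z, -, rfl⟩
  exact hp.nonneg g z⟩

theorem aLetter_le (hp : IsTransitionKernel p) (k : ℕ) (g : G) {w : Hist G}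
    (hw : w ∈ admissible p) : aLetter p k g w ≤ p g w :=
  csInf_le (bddBelow_image hp g _) ⟨w, ⟨hw, rfl⟩, rfl⟩

theorem aLetter_mono (hp : IsTransitionKernel p) (g : G) {w : Hist G} (hw : w ∈ admissible p) :
    Monotone fun k => aLetter p k g w := by
  intro j k hjk
  refine csInf_le_csInf (bddBelow_image hp g _) ⟨_, w, ⟨hw, rfl⟩, rfl⟩ (image_mono ?_)
  rintro z ⟨hz, h⟩
  exact ⟨hz, word_eq_of_le hjk h⟩

theorem bLetter_nonneg (hp : IsTransitionKernel p) (k : ℕ) (g : G) {w : Hist G}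
    (hw : w ∈ admissible p) : 0 ≤ bLetter p k g w := by
  cases k with
  | zero => exact aLetter_nonneg hp 0 g w
  | succ k => exact sub_nonneg.2 (aLetter_mono hp g hw k.le_succ)

theorem aSum_nonneg (hp : IsTransitionKernel p) (k : ℕ) (w : Hist G) : 0 ≤ aSum p k w :=
  Finset.sum_nonneg fun g _ => aLetter_nonneg hp k g w

theorem aSum_le_one (hp : IsTransitionKernel p) (k : ℕ) {w : Hist G} (hw : w ∈ admissible p) :
    aSum p k w ≤ 1 := by
  rw [← hp.sum_eq_one w]
  exact Finset.sum_le_sum fun g _ => aLetter_le hp k g hw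

theorem aSum_mono (hp : IsTransitionKernel p) {w : Hist G} (hw : w ∈ admissible p) :
    Monotone fun k => aSum p k w := fun _ _ hjk =>
  Finset.sum_le_sum fun g _ => aLetter_mono hp g hw hjk

theorem aMin_le_aSum (hp : IsTransitionKernel p) (k : ℕ) {w : Hist G} (hw : w ∈ admissible p) :
    aMin p k ≤ aSum p k w := by
  refine csInf_le ⟨0, ?_⟩ ⟨w, hw, rfl⟩
  rintro _ ⟨z, -, rfl⟩
  exact aSum_nonneg hp k z

theorem aMin_nonneg (hp : IsTransitionKernel p) (k : ℕ) : 0 ≤ aMin p k := by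
  refine Real.sInf_nonneg ?_
  rintro _ ⟨z, -, rfl⟩
  exact aSum_nonneg hp k z

/-- Divergence of `∑ ∏ aₘ` forces `aₖ` to exceed every `r < 1`: otherwise the series would be
dominated by a geometric one. -/
theorem exists_lt_aMin (hp : IsTransitionKernel p)
    (h_div : Tendsto (fun N : ℕ => ∑ n ∈ Finset.Icc 1 N, ∏ m ∈ Finset.Icc 1 n, aMin p m)
      atTop atTop) {r : ℝ} (hr : r < 1) : ∃ k, 1 ≤ k ∧ r < aMin p k := by
  by_contra! hcon
  have hr0 : 0 ≤ r := (aMin_nonneg hp 1).trans (hcon 1 le_rfl)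
  have hb : ∀ N : ℕ, ∑ n ∈ Finset.Icc 1 N, ∏ m ∈ Finset.Icc 1 n, aMin p m ≤ (1 - r)⁻¹ := by
    intro N
    calc ∑ n ∈ Finset.Icc 1 N, ∏ m ∈ Finset.Icc 1 n, aMin p m
        ≤ ∑ n ∈ Finset.Icc 1 N, r ^ n := Finset.sum_le_sum fun n _ => by
          calc ∏ m ∈ Finset.Icc 1 n, aMin p m ≤ ∏ m ∈ Finset.Icc 1 n, r :=
                Finset.prod_le_prod (fun m _ => aMin_nonneg hp m)
                  fun m hm => hcon m (Finset.mem_Icc.1 hm).1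
            _ = r ^ n := by simp
      _ ≤ ∑' n, r ^ n := (summable_geometric_of_lt_one hr0 hr).sum_le_tsum _
          fun _ _ => pow_nonneg hr0 _
      _ = (1 - r)⁻¹ := tsum_geometric_of_lt_one hr0 hr
  obtain ⟨N, hN⟩ := (h_div.eventually_gt_atTop ((1 - r)⁻¹)).exists
  exact absurd (hb N) (not_le.2 hN)

theorem aMin_one_pos (hp : IsTransitionKernel p)
    (h_div : Tendsto (fun N : ℕ => ∑ n ∈ Finset.Icc 1 N, ∏ m ∈ Finset.Icc 1 n, aMin p m)
      atTop atTop) : 0 < aMin p 1 := by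
  refine (aMin_nonneg hp 1).lt_of_ne fun h => ?_
  obtain ⟨N, hN⟩ := (h_div.eventually_gt_atTop 0).exists
  refine hN.ne' (Finset.sum_eq_zero fun n hn => Finset.prod_eq_zero (i := 1) ?_ h.symm)
  exact Finset.mem_Icc.2 ⟨le_rfl, (Finset.mem_Icc.1 hn).1⟩

theorem exists_lt_aSum (hp : IsTransitionKernel p)
    (h_lim : ∀ r < 1, ∃ k, 1 ≤ k ∧ r < aMin p k) {w : Hist G} (hw : w ∈ admissible p)
    {r : ℝ} (hr : r < 1) : ∃ k, r < aSum p k w := by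
  obtain ⟨k, -, hk⟩ := h_lim r hr
  exact ⟨k, hk.trans_le (aMin_le_aSum hp k hw)⟩

theorem tendsto_aLetter (hp : IsTransitionKernel p)
    (h_lim : ∀ r < 1, ∃ k, 1 ≤ k ∧ r < aMin p k) {w : Hist G} (hw : w ∈ admissible p) (g : G) :
    Tendsto (fun k => aLetter p k g w) atTop (nhds (p g w)) := by
  refine tendsto_order.2 ⟨fun r hr => ?_, fun r hr => Eventually.of_forall fun k =>
    (aLetter_le hp k g hw).trans_lt hr⟩
  obtain ⟨k, hk⟩ := exists_lt_aSum hp h_lim hw (r := 1 - (p g w - r)) (by linarith)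
  filter_upwards [eventually_ge_atTop k] with j hj
  have h1 : p g w - aLetter p j g w ≤ ∑ h, (p h w - aLetter p j h w) :=
    Finset.single_le_sum (f := fun h => p h w - aLetter p j h w)
      (fun h _ => sub_nonneg.2 (aLetter_le hp j h hw)) (Finset.mem_univ g)
  rw [Finset.sum_sub_distrib, hp.sum_eq_one] at h1
  have h2 : aSum p k w ≤ aSum p j w := aSum_mono hp hw hj
  simp only [aSum] at h2 hk
  linarith

end Coefficients

/-! ### Existence of maximal couplings and of rearrangements -/

section Stack

variable {G : Type*} [Fintype G]

/-- Left endpoint of the interval of `g` when intervals of lengths `ℓ h`, `h ∈ G`, are laid end to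
end from `0`, in the order of an enumeration of `G`. -/
noncomputable def stack (ℓ : G → ℝ) (g : G) : ℝ :=
  ∑ h with Fintype.equivFin G h < Fintype.equivFin G g, ℓ h

theorem stack_nonneg {ℓ : G → ℝ} (hℓ : ∀ g, 0 ≤ ℓ g) (g : G) : 0 ≤ stack ℓ g :=
  Finset.sum_nonneg fun h _ => hℓ h

theorem stack_add_eq (ℓ : G → ℝ) (g : G) :
    stack ℓ g + ℓ g = ∑ h with Fintype.equivFin G h ≤ Fintype.equivFin G g, ℓ h := by
  classical
  have : (Finset.univ.filter fun h => Fintype.equivFin G h ≤ Fintype.equivFin G g) =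
      insert g (Finset.univ.filter fun h => Fintype.equivFin G h < Fintype.equivFin G g) := by
    ext h
    simp [le_iff_eq_or_lt]
  rw [this, Finset.sum_insert (by simp), add_comm, stack]

theorem stack_add_le_sum {ℓ : G → ℝ} (hℓ : ∀ g, 0 ≤ ℓ g) (g : G) :
    stack ℓ g + ℓ g ≤ ∑ h, ℓ h := by
  rw [stack_add_eq]
  exact Finset.sum_le_sum_of_subset_of_nonneg (Finset.filter_subset _ _) fun h _ _ => hℓ h

theorem stack_add_le_stack {ℓ : G → ℝ} (hℓ : ∀ g, 0 ≤ ℓ g) {g h : G}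
    (hgh : Fintype.equivFin G g < Fintype.equivFin G h) : stack ℓ g + ℓ g ≤ stack ℓ h := by
  rw [stack_add_eq]
  refine Finset.sum_le_sum_of_subset_of_nonneg (fun x hx => ?_) fun h _ _ => hℓ h
  simp only [Finset.mem_filter, Finset.mem_univ, true_and] at hx ⊢
  exact hx.trans_lt hgh

theorem existsUnique_mem_stack {ℓ : G → ℝ} (hℓ : ∀ g, 0 ≤ ℓ g) {s u : ℝ}
    (hu : u ∈ Ico s (s + ∑ g, ℓ g)) :
    ∃! g, u ∈ Ico (s + stack ℓ g) (s + stack ℓ g + ℓ g) := by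
  classical
  obtain ⟨hu1, hu2⟩ := hu
  -- the letter sought is the first one whose interval ends after `u`
  have hne : (Finset.univ.filter fun g => u < s + stack ℓ g + ℓ g).Nonempty := by
    by_contra hcon
    rw [Finset.not_nonempty_iff_eq_empty, Finset.filter_eq_empty_iff] at hcon
    rcases isEmpty_or_nonempty G with hG | hG
    · simp at hu2
      linarith
    · obtain ⟨g, -, hg⟩ := Finset.exists_max_image Finset.univ (Fintype.equivFin G)
        Finset.univ_nonempty
      have h1 : stack ℓ g + ℓ g = ∑ h, ℓ h := by
        rw [stack_add_eq, Finset.filter_true_of_mem hg]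
      have := hcon (Finset.mem_univ g)
      linarith
  obtain ⟨g, hg, hmin⟩ := Finset.exists_min_image _ (Fintype.equivFin G) hne
  simp only [Finset.mem_filter, Finset.mem_univ, true_and] at hg hmin
  have huniq : ∀ a b, u ∈ Ico (s + stack ℓ a) (s + stack ℓ a + ℓ a) →
      u ∈ Ico (s + stack ℓ b) (s + stack ℓ b + ℓ b) →
      ¬ Fintype.equivFin G a < Fintype.equivFin G b := by
    intro a b ha hb hab
    have := stack_add_le_stack hℓ hab
    linarith [ha.2, hb.1]
  have hlow : s + stack ℓ g ≤ u := by
    by_cases h0 : (Fintype.equivFin G g : ℕ) = 0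
    · have : stack ℓ g = 0 := by
        refine Finset.sum_eq_zero fun h hh => ?_
        simp only [Finset.mem_filter, Fin.lt_def, h0] at hh
        omega
      linarith
    · obtain ⟨h, hh⟩ : ∃ h, (Fintype.equivFin G h : ℕ) + 1 = Fintype.equivFin G g :=
        ⟨(Fintype.equivFin G).symm ⟨(Fintype.equivFin G g : ℕ) - 1, by omega⟩, by
          simp only [Equiv.apply_symm_apply]; omega⟩
      have h1 : stack ℓ g = stack ℓ h + ℓ h := by
        rw [stack_add_eq, stack]
        congr 1
        ext x
        simp only [Finset.mem_filter, Finset.mem_univ, true_and, Fin.lt_def, Fin.le_def]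
        omega
      have h2 : ¬ u < s + stack ℓ h + ℓ h := fun hlt => by
        have := hmin h hlt
        rw [Fin.le_def] at this
        omega
      linarith
  refine ⟨g, ⟨hlow, hg⟩, fun b hb => ?_⟩
  by_contra hne
  rcases lt_or_gt_of_ne fun h => hne ((Fintype.equivFin G).injective h) with h | h
  · exact huniq b g hb ⟨hlow, hg⟩ h
  · exact huniq g b ⟨hlow, hg⟩ hb h

end Stack

section Existence

variable {G : Type*} [Fintype G] [MeasurableSpace G] {p : G → Hist G → ℝ}

theorem level_unique (hp : IsTransitionKernel p) {w : Hist G} (hw : w ∈ admissible p) {u : ℝ}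
    {j k : ℕ} (hj : u ∈ Ico (aSumPrev p j w) (aSum p j w))
    (hk : u ∈ Ico (aSumPrev p k w) (aSum p k w)) : j = k := by
  have key : ∀ i l, u ∈ Ico (aSumPrev p i w) (aSum p i w) →
      u ∈ Ico (aSumPrev p l w) (aSum p l w) → ¬ i < l := by
    intro i l hi hl hil
    obtain ⟨l, rfl⟩ : ∃ m, l = m + 1 := ⟨l - 1, by omega⟩
    exact (hi.2.trans_le (aSum_mono hp hw (Nat.lt_succ_iff.1 hil))).not_ge hl.1
  rcases lt_trichotomy j k with h | h | h
  · exact (key j k hj hk h).elim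
  · exact h
  · exact (key k j hk hj h).elim

theorem exists_isMaximalCoupling [Nonempty G] (hp : IsTransitionKernel p) :
    ∃ f, IsMaximalCoupling p f := by
  classical
  -- the left endpoint as a function of the history; it depends on the last `k` letters only
  let L : ℕ → G → Hist G → ℝ := fun k g w => aSumPrev p k w + stack (fun h => bLetter p k h w) g
  have hL : ∀ k g (w z : Hist G), word w k = word z k → L k g w = L k g z := by
    intro k g w z h
    simp only [L, aSumPrev_congr h, bLetter_congr h]
  let c : ℕ → G → List G → ℝ := fun k g t =>
    if h : ∃ w : Hist G, word w k = t then L k g h.choose else 0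
  have hc : ∀ k g (w : Hist G), c k g (word w k) = L k g w := by
    intro k g w
    have h : ∃ z : Hist G, word z k = word w k := ⟨w, rfl⟩
    simp only [c, dif_pos h]
    exact hL k g _ _ h.choose_spec
  refine ⟨fun u w => Classical.epsilon fun g => ∃ k, u ∈ Ico (aSumPrev p k w) (aSum p k w) ∧
    u ∈ Ico (L k g w) (L k g w + bLetter p k g w), c, fun w hw k => ?_⟩
  have hb : ∀ g, 0 ≤ bLetter p k g w := fun g => bLetter_nonneg hp k g hw
  have hsum := sum_bLetter (p := p) k w
  simp only [hc]
  refine ⟨fun g => Ico_subset_Ico ?_ ?_, fun u hu g => ?_⟩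
  · have := stack_nonneg hb g
    simp only [L]
    linarith
  · have := stack_add_le_sum hb g
    simp only [L]
    linarith
  · obtain ⟨g', hg', huniq⟩ := existsUnique_mem_stack hb (s := aSumPrev p k w) (u := u)
      (by rw [hsum]; simpa using hu)
    have hspec := Classical.epsilon_spec (p := fun g => ∃ k,
      u ∈ Ico (aSumPrev p k w) (aSum p k w) ∧ u ∈ Ico (L k g w) (L k g w + bLetter p k g w))
      ⟨g', k, hu, hg'⟩
    obtain ⟨j, hj, hj'⟩ := hspec
    obtain rfl := level_unique hp hw hj hu
    constructor
    · rintro rfl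
      exact hj'
    · intro hg
      rw [huniq g hg]
      exact huniq _ hj'

/-- Each interval of length `a₁(h | w)` is cut in the proportion `a₁ : a₁(w) - a₁`; the first parts
then exactly fill `[0, a₁)` and the second ones `[a₁, a₁(w))`. -/
theorem exists_isRearrangement [Nonempty G] (hp : IsTransitionKernel p) (h_pos : 0 < aMin p 1)
    (f : ℝ → Hist G → G) : ∃ fbar, IsRearrangement p f fbar := by
  classical
  let ℓ₁ : Hist G → G → ℝ := fun w h => aMin p 1 / aSum p 1 w * aLetter p 1 h w
  let ℓ₂ : Hist G → G → ℝ := fun w h => (1 - aMin p 1 / aSum p 1 w) * aLetter p 1 h w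
  have hcongr : ∀ w z : Hist G, w 0 = z 0 → ℓ₁ w = ℓ₁ z ∧ ℓ₂ w = ℓ₂ z := by
    intro w z h
    have h' := word_one_eq_iff.2 h
    constructor <;> funext g <;> simp only [ℓ₁, ℓ₂, aSum_congr h', aLetter_congr h']
  let c₁ : G → G → ℝ := fun h x => stack (ℓ₁ fun _ => x) h
  let d₁ : G → G → ℝ := fun h x => stack (ℓ₁ fun _ => x) h + ℓ₁ (fun _ => x) h
  let c₂ : G → G → ℝ := fun h x => aMin p 1 + stack (ℓ₂ fun _ => x) h
  let d₂ : G → G → ℝ := fun h x => aMin p 1 + stack (ℓ₂ fun _ => x) h + ℓ₂ (fun _ => x) h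
  refine ⟨fun u w => if u < aSum p 1 w then Classical.epsilon fun h =>
    u ∈ Ico (c₁ h (w 0)) (d₁ h (w 0)) ∪ Ico (c₂ h (w 0)) (d₂ h (w 0)) else f u w,
    c₁, d₁, c₂, d₂, fun w hw => ?_⟩
  obtain ⟨e1, e2⟩ := hcongr (fun _ => w 0) w rfl
  have hle : aMin p 1 ≤ aSum p 1 w := aMin_le_aSum hp 1 hw
  have hθ0 : 0 < aMin p 1 / aSum p 1 w := div_pos h_pos (h_pos.trans_le hle)
  have hθ1 : aMin p 1 / aSum p 1 w ≤ 1 := div_le_one_of_le₀ hle (h_pos.le.trans hle)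
  have n1 : ∀ h, 0 ≤ ℓ₁ w h := fun h => mul_nonneg hθ0.le (aLetter_nonneg hp 1 h w)
  have n2 : ∀ h, 0 ≤ ℓ₂ w h := fun h =>
    mul_nonneg (sub_nonneg.2 hθ1) (aLetter_nonneg hp 1 h w)
  have s1 : ∑ h, ℓ₁ w h = aMin p 1 := by
    simp only [ℓ₁, ← Finset.mul_sum]
    exact div_mul_cancel₀ _ (h_pos.trans_le hle).ne'
  have s2 : ∑ h, ℓ₂ w h = aSum p 1 w - aMin p 1 := by
    simp only [ℓ₂, ← Finset.mul_sum]
    rw [sub_mul, one_mul]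
    exact congrArg₂ _ rfl (div_mul_cancel₀ _ (h_pos.trans_le hle).ne')
  have k1 := stack_nonneg n1
  have k2 := stack_nonneg n2
  have l1 := fun h => stack_add_le_sum n1 h
  have l2 := fun h => stack_add_le_sum n2 h
  simp only [s1, s2] at l1 l2
  simp only [c₁, d₁, c₂, d₂, e1, e2]
  refine ⟨fun h => ⟨by linarith [n1 h], by linarith [n2 h], union_subset
    (Ico_subset_Ico (k1 h) ((l1 h).trans hle))
    (Ico_subset_Ico (by linarith [k2 h]) (by linarith [l2 h])), ?_, ?_, fun hpos => ?_⟩,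
    fun u hu h => ?_, fun u hu => if_neg (not_lt.2 hu.1)⟩
  · rw [Set.disjoint_left]
    intro u h1 h2
    linarith [h1.2, h2.1, l1 h, k2 h]
  · simp only [ℓ₁, ℓ₂]
    ring
  · have : 0 < ℓ₁ w h := mul_pos hθ0 hpos
    exact ⟨stack (ℓ₁ w) h, ⟨le_rfl, by linarith⟩, k1 h, by linarith [l1 h]⟩
  · obtain ⟨h', hh', huniq⟩ : ∃! h, u ∈ Ico (stack (ℓ₁ w) h) (stack (ℓ₁ w) h + ℓ₁ w h) ∪
        Ico (aMin p 1 + stack (ℓ₂ w) h) (aMin p 1 + stack (ℓ₂ w) h + ℓ₂ w h) := by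
      rcases lt_or_ge u (aMin p 1) with hlt | hge
      · obtain ⟨h', hh', huniq⟩ := existsUnique_mem_stack n1 (s := 0) (u := u)
          (by rw [s1, zero_add]; exact ⟨hu.1, hlt⟩)
        simp only [zero_add] at hh' huniq
        refine ⟨h', Or.inl hh', ?_⟩
        rintro y (hy | hy)
        · exact huniq y hy
        · linarith [hy.1, k2 y]
      · obtain ⟨h', hh', huniq⟩ := existsUnique_mem_stack n2 (s := aMin p 1) (u := u)
          (by rw [s2, add_sub_cancel]; exact ⟨hge, hu.2⟩)
        refine ⟨h', Or.inr hh', ?_⟩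
        rintro y (hy | hy)
        · linarith [hy.2, l1 y]
        · exact huniq y hy
    rw [if_pos hu.2]
    have hspec := Classical.epsilon_spec (p := fun h =>
      u ∈ Ico (stack (ℓ₁ w) h) (stack (ℓ₁ w) h + ℓ₁ w h) ∪
        Ico (aMin p 1 + stack (ℓ₂ w) h) (aMin p 1 + stack (ℓ₂ w) h + ℓ₂ w h)) ⟨h', hh'⟩
    constructor
    · rintro rfl
      exact hspec
    · intro hg
      rw [huniq h hg]
      exact huniq _ hspec

end Existence

/-! ### Rearranged couplings -/

section Rearranged

variable {G : Type*} [Fintype G] {p : G → Hist G → ℝ}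
  {f fbar : ℝ → Hist G → G}

theorem exists_level {w : Hist G} {u : ℝ} (hu : 0 ≤ u) {k : ℕ} (hk : u < aSum p k w) :
    ∃ j ≤ k, u ∈ Ico (aSumPrev p j w) (aSum p j w) := by
  classical
  have h : ∃ j, u < aSum p j w := ⟨k, hk⟩
  refine ⟨Nat.find h, Nat.find_min' h hk, ?_, Nat.find_spec h⟩
  rcases hj : Nat.find h with _ | j
  · exact hu
  · exact not_lt.1 (Nat.find_min h (m := j) (by omega))

theorem maximalCoupling_congr (hf : IsMaximalCoupling p f) {w z : Hist G}
    (hw : w ∈ admissible p) (hz : z ∈ admissible p) {k : ℕ} (h : word w k = word z k) {u : ℝ}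
    (hu : 0 ≤ u) (huk : u < aSum p k w) : f u w = f u z := by
  obtain ⟨c, hc⟩ := hf
  obtain ⟨j, hjk, hj⟩ := exists_level hu huk
  have hwz := word_eq_of_le hjk h
  have h1 := ((hc w hw j).2 u hj (f u w)).1 rfl
  rw [hwz, bLetter_congr hwz] at h1
  rw [aSumPrev_congr hwz, aSum_congr hwz] at hj
  exact (((hc z hz j).2 u hj (f u w)).2 h1).symm

variable [MeasurableSpace G]

theorem rearrangement_congr (hp : IsTransitionKernel p) (hf : IsMaximalCoupling p f)
    (hfbar : IsRearrangement p f fbar) {w z : Hist G}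
    (hw : w ∈ admissible p) (hz : z ∈ admissible p) {k : ℕ} (hk : 1 ≤ k)
    (h : word w k = word z k) {u : ℝ} (hu : 0 ≤ u) (huk : u < aSum p k w) :
    fbar u w = fbar u z := by
  obtain ⟨c₁, d₁, c₂, d₂, hc⟩ := hfbar
  have h0 : w 0 = z 0 := word_eq_word_iff.1 h 0 hk
  have h1 := word_one_eq_iff.2 h0
  rcases lt_or_ge u (aSum p 1 w) with hlt | hge
  · have h2 := ((hc w hw).2.1 u ⟨hu, hlt⟩ (fbar u w)).1 rfl
    rw [h0] at h2
    rw [aSum_congr h1] at hlt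
    exact (((hc z hz).2.1 u ⟨hu, hlt⟩ (fbar u w)).2 h2).symm
  · have hu1 : u < 1 := huk.trans_le (aSum_le_one hp k hw)
    rw [(hc w hw).2.2 u ⟨hge, hu1⟩, (hc z hz).2.2 u ⟨by rwa [← aSum_congr h1], hu1⟩]
    exact maximalCoupling_congr hf hw hz h hu huk

theorem rearrangement_pos (hp : IsTransitionKernel p)
    (h_lim : ∀ r < 1, ∃ k, 1 ≤ k ∧ r < aMin p k) (hf : IsMaximalCoupling p f)
    (hfbar : IsRearrangement p f fbar) {w : Hist G} (hw : w ∈ admissible p) {u : ℝ}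
    (hu : u ∈ Ico (0 : ℝ) 1) : 0 < p (fbar u w) w := by
  obtain ⟨c₁, d₁, c₂, d₂, hc⟩ := hfbar
  rcases lt_or_ge u (aSum p 1 w) with hlt | hge
  · refine lt_of_lt_of_le ?_ (aLetter_le hp 1 _ hw)
    have h2 := ((hc w hw).2.1 u ⟨hu.1, hlt⟩ (fbar u w)).1 rfl
    obtain ⟨l1, l2, -, -, h3, -⟩ := (hc w hw).1 (fbar u w)
    rcases h2 with h2 | h2 <;> linarith [h2.1, h2.2]
  · rw [(hc w hw).2.2 u ⟨hge, hu.2⟩]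
    obtain ⟨k, hk⟩ := exists_lt_aSum hp h_lim hw hu.2
    obtain ⟨j, -, hj⟩ := exists_level hu.1 hk
    obtain ⟨c, hc'⟩ := hf
    have h1 := ((hc' w hw j).2 u hj (f u w)).1 rfl
    have hb : 0 < bLetter p j (f u w) w := by linarith [h1.1, h1.2]
    refine lt_of_lt_of_le ?_ (aLetter_le hp j _ hw)
    cases j with
    | zero => exact hb
    | succ j => exact (aLetter_nonneg hp j _ w).trans_lt (sub_pos.1 hb)

/-- Up to the level `aₖ(w)`, the value `g` is taken on a set of measure `aₖ(g | w)`. -/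
theorem volume_rearrangement_below (hp : IsTransitionKernel p) (hf : IsMaximalCoupling p f)
    (hfbar : IsRearrangement p f fbar) {w : Hist G} (hw : w ∈ admissible p) (g : G) (k : ℕ) :
    MeasurableSet {u | u ∈ Ico 0 (aSum p (k + 1) w) ∧ fbar u w = g} ∧
      volume {u | u ∈ Ico 0 (aSum p (k + 1) w) ∧ fbar u w = g} =
        ENNReal.ofReal (aLetter p (k + 1) g w) := by
  obtain ⟨c₁, d₁, c₂, d₂, hc⟩ := hfbar
  induction k with
  | zero =>
    obtain ⟨l1, l2, hsub, hdis, h3, -⟩ := (hc w hw).1 g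
    have : {u | u ∈ Ico 0 (aSum p (0 + 1) w) ∧ fbar u w = g} =
        Ico (c₁ g (w 0)) (d₁ g (w 0)) ∪ Ico (c₂ g (w 0)) (d₂ g (w 0)) := by
      ext u
      exact ⟨fun hu => ((hc w hw).2.1 u hu.1 g).1 hu.2,
        fun hu => ⟨hsub hu, ((hc w hw).2.1 u (hsub hu) g).2 hu⟩⟩
    rw [this]
    refine ⟨measurableSet_Ico.union measurableSet_Ico, ?_⟩
    rw [measure_union hdis measurableSet_Ico, Real.volume_Ico, Real.volume_Ico,
      ← ENNReal.ofReal_add (sub_nonneg.2 l1) (sub_nonneg.2 l2), h3]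
  | succ k ih =>
    obtain ⟨c, hc'⟩ := hf
    obtain ⟨hsub, hval⟩ := hc' w hw (k + 1 + 1)
    have hmono : aSum p (k + 1) w ≤ aSum p (k + 1 + 1) w := aSum_mono hp hw (k + 1).le_succ
    have h1k : aSum p 1 w ≤ aSum p (k + 1) w := aSum_mono hp hw (by omega)
    have hfb : ∀ u ∈ Ico (aSum p (k + 1) w) (aSum p (k + 1 + 1) w), fbar u w = f u w :=
      fun u hu => (hc w hw).2.2 u
        ⟨h1k.trans hu.1, hu.2.trans_le (aSum_le_one hp _ hw)⟩
    set a := c (k + 1 + 1) g (word w (k + 1 + 1))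
    have : {u | u ∈ Ico 0 (aSum p (k + 1 + 1) w) ∧ fbar u w = g} =
        {u | u ∈ Ico 0 (aSum p (k + 1) w) ∧ fbar u w = g} ∪
          Ico a (a + bLetter p (k + 1 + 1) g w) := by
      ext u
      constructor
      · rintro ⟨hu, hg⟩
        rcases lt_or_ge u (aSum p (k + 1) w) with hlt | hge
        · exact Or.inl ⟨⟨hu.1, hlt⟩, hg⟩
        · exact Or.inr ((hval u ⟨hge, hu.2⟩ g).1 (by rw [← hfb u ⟨hge, hu.2⟩, hg]))
      · rintro (⟨hu, hg⟩ | hu)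
        · exact ⟨⟨hu.1, hu.2.trans_le hmono⟩, hg⟩
        · have hu' := hsub g hu
          exact ⟨⟨(aSum_nonneg hp (k + 1) w).trans hu'.1, hu'.2⟩,
            by rw [hfb u hu']; exact (hval u hu' g).2 hu⟩
    rw [this]
    refine ⟨ih.1.union measurableSet_Ico, ?_⟩
    rw [measure_union _ measurableSet_Ico, ih.2, Real.volume_Ico,
      ← ENNReal.ofReal_add (aLetter_nonneg hp _ g w)
        (by simpa using bLetter_nonneg hp (k + 1 + 1) g hw)]
    · congr 1
      simp [bLetter]
    · rw [Set.disjoint_left]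
      intro u h1 h2
      exact h1.1.2.not_ge (hsub g h2).1

theorem volume_rearrangement (hp : IsTransitionKernel p)
    (h_lim : ∀ r < 1, ∃ k, 1 ≤ k ∧ r < aMin p k) (hf : IsMaximalCoupling p f)
    (hfbar : IsRearrangement p f fbar) {w : Hist G} (hw : w ∈ admissible p) (g : G) :
    MeasurableSet {u | u ∈ Ico (0 : ℝ) 1 ∧ fbar u w = g} ∧
      volume {u | u ∈ Ico (0 : ℝ) 1 ∧ fbar u w = g} = ENNReal.ofReal (p g w) := by
  have hk := volume_rearrangement_below hp hf hfbar hw g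
  have hU : {u | u ∈ Ico (0 : ℝ) 1 ∧ fbar u w = g} =
      ⋃ k, {u | u ∈ Ico 0 (aSum p (k + 1) w) ∧ fbar u w = g} := by
    ext u
    simp only [mem_iUnion, mem_ofPred_eq]
    constructor
    · rintro ⟨hu, hg⟩
      obtain ⟨k, hk⟩ := exists_lt_aSum hp h_lim hw hu.2
      exact ⟨k, ⟨hu.1, hk.trans_le (aSum_mono hp hw k.le_succ)⟩, hg⟩
    · rintro ⟨k, hu, hg⟩
      exact ⟨⟨hu.1, hu.2.trans_le (aSum_le_one hp _ hw)⟩, hg⟩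
  rw [hU]
  refine ⟨MeasurableSet.iUnion fun k => (hk k).1, ?_⟩
  have h1 := tendsto_measure_iUnion_atTop (μ := volume)
    (s := fun k => {u | u ∈ Ico 0 (aSum p (k + 1) w) ∧ fbar u w = g}) (by
      intro i j hij u hu
      exact ⟨⟨hu.1.1, hu.1.2.trans_le (aSum_mono hp hw (by omega))⟩, hu.2⟩)
  have h2 : Tendsto (fun k => ENNReal.ofReal (aLetter p (k + 1) g w)) atTop
      (nhds (ENNReal.ofReal (p g w))) :=
    (ENNReal.continuous_ofReal.tendsto _).comp
      ((tendsto_aLetter hp h_lim hw g).comp (tendsto_add_atTop_nat 1))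
  refine tendsto_nhds_unique h1 (h2.congr fun k => ?_)
  exact (hk k).2.symm

end Rearranged

/-! ### The modified coupling function -/

section Modified

variable {G : Type*} [Fintype G] {p : G → Hist G → ℝ}
  {f fbar : ℝ → Hist G → G}

/-- What the coalescence argument uses of a coupling function `F` driven by points of the cube:
it reproduces the kernel, it only ever chooses letters of positive probability, below the level
`aₖ` it reads the last `k` letters only, and in the Markov regime `u⁰ < a₁` each arc `(x, h)` is
followed when the coordinate `u^x` belongs to a suitable set of positive measure. -/
structure IsLocalCoupling (p : G → Hist G → ℝ) (F : Cube G → Hist G → G) : Prop where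
  reproduces : Reproduces p F
  pos : ∀ w ∈ admissible p, ∀ v, 0 < p (F v w) w
  congr : ∀ k, 1 ≤ k → ∀ v : Cube G, (v.1 : ℝ) < aMin p k → ∀ w ∈ admissible p,
    ∀ z ∈ admissible p, word w k = word z k → F v w = F v z
  markov : ∀ x h, (∃ w ∈ admissible p, w 0 = x ∧ 0 < aLetter p 1 h w) →
    ∃ T : Set I01, MeasurableSet T ∧ unif01 T ≠ 0 ∧ ∀ v : Cube G, (v.1 : ℝ) < aMin p 1 →
      v.2 x ∈ T → ∀ w ∈ admissible p, w 0 = x → F v w = h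

theorem unif01_apply (T : Set ℝ) : unif01 (Subtype.val ⁻¹' T) = volume (T ∩ Ico (0 : ℝ) 1) := by
  rw [unif01, comap_subtype_coe_apply measurableSet_Ico, Subtype.image_preimage_coe, inter_comm]

/-- If `U` is uniform on `[0, 1)` then `a * U` is uniform on `[0, a)`. -/
theorem unif01_mul_mem {a : ℝ} (ha : 0 < a) (T : Set ℝ) :
    unif01 {u : I01 | a * (u : ℝ) ∈ T} = ENNReal.ofReal a⁻¹ * volume (T ∩ Ico 0 a) := by
  have h1 : {u : I01 | a * (u : ℝ) ∈ T} = Subtype.val ⁻¹' {u : ℝ | a * u ∈ T} := rfl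
  have h2 : {u : ℝ | a * u ∈ T} ∩ Ico 0 1 = (fun u => a * u) ⁻¹' (T ∩ Ico 0 a) := by
    ext u
    simp only [mem_inter_iff, mem_ofPred_eq, mem_preimage, mem_Ico, mul_nonneg_iff_of_pos_left ha,
      mul_lt_iff_lt_one_right ha]
  rw [h1, unif01_apply, h2, Real.volume_preimage_mul_left ha.ne', abs_of_pos (inv_pos.2 ha)]

theorem cubeLaw_fst (T : Set I01) : cubeLaw G {v | v.1 ∈ T} = unif01 T := by
  have : {v : Cube G | v.1 ∈ T} = T ×ˢ univ := by ext; simp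
  rw [this, cubeLaw, Measure.prod_prod, measure_univ, mul_one]

variable [MeasurableSpace G]

theorem reproduces_fhat (hp : IsTransitionKernel p)
    (h_lim : ∀ r < 1, ∃ k, 1 ≤ k ∧ r < aMin p k) (h_pos : 0 < aMin p 1)
    (hf : IsMaximalCoupling p f) (hfbar : IsRearrangement p f fbar) :
    Reproduces p (fhat p fbar) := by
  intro w hw g
  obtain ⟨hSm, hSv⟩ := volume_rearrangement hp h_lim hf hfbar hw g
  set S := {u | u ∈ Ico (0 : ℝ) 1 ∧ fbar u w = g} with hS
  have ha1 : aMin p 1 ≤ 1 := (aMin_le_aSum hp 1 hw).trans (aSum_le_one hp 1 hw)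
  have hset : {v : Cube G | fhat p fbar v w = g} =
      ({u : I01 | (u : ℝ) < aMin p 1} ×ˢ
        ((fun v => v (w 0)) ⁻¹' {u : I01 | aMin p 1 * (u : ℝ) ∈ S})) ∪
      {v | v.1 ∈ (Subtype.val ⁻¹' (S ∩ Ici (aMin p 1)) : Set I01)} := by
    ext v
    have m1 : aMin p 1 * (v.2 (w 0) : ℝ) ∈ Ico (0 : ℝ) 1 :=
      ⟨mul_nonneg h_pos.le (v.2 (w 0)).2.1, mul_lt_one_of_nonneg_of_lt_one_right ha1
        (v.2 (w 0)).2.1 (v.2 (w 0)).2.2⟩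
    by_cases hv : (v.1 : ℝ) < aMin p 1
    · simp [fhat, hv, hS, m1.1, m1.2]
    · simp [fhat, hv, hS, not_lt.1 hv, v.1.2.1, v.1.2.2]
  have hm1 : MeasurableSet {u : I01 | (u : ℝ) < aMin p 1} :=
    measurableSet_lt measurable_subtype_coe measurable_const
  have hm2 : MeasurableSet {u : I01 | aMin p 1 * (u : ℝ) ∈ S} :=
    (measurable_subtype_coe.const_mul _) hSm
  have hm3 : MeasurableSet {v : Cube G |
      v.1 ∈ (Subtype.val ⁻¹' (S ∩ Ici (aMin p 1)) : Set I01)} :=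
    measurable_fst (measurable_subtype_coe (hSm.inter measurableSet_Ici))
  rw [hset]
  refine ⟨(hm1.prod (measurable_pi_apply (w 0) hm2)).union hm3, ?_⟩
  rw [measure_union _ hm3, cubeLaw_fst, cubeLaw, Measure.prod_prod,
    (measurePreserving_eval (fun _ : G => unif01) (w 0)).measure_preimage hm2.nullMeasurableSet,
    unif01_mul_mem h_pos, show {u : I01 | (u : ℝ) < aMin p 1} =
      Subtype.val ⁻¹' Iio (aMin p 1) from rfl, unif01_apply, unif01_apply]
  · have e1 : Iio (aMin p 1) ∩ Ico (0 : ℝ) 1 = Ico 0 (aMin p 1) := by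
      ext u
      simp only [mem_inter_iff, mem_Iio, mem_Ico]
      constructor
      · rintro ⟨h1, h2, -⟩
        exact ⟨h2, h1⟩
      · rintro ⟨h1, h2⟩
        exact ⟨h2, h1, h2.trans_le ha1⟩
    have e2 : S ∩ Ici (aMin p 1) ∩ Ico (0 : ℝ) 1 = S \ Ico 0 (aMin p 1) := by
      ext u
      simp only [hS, mem_inter_iff, mem_Ici, mem_Ico, Set.mem_sdiff, mem_ofPred_eq, not_and, not_lt]
      tauto
    rw [e1, e2, Real.volume_Ico, sub_zero, ← mul_assoc, ← ENNReal.ofReal_mul h_pos.le,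
      mul_inv_cancel₀ h_pos.ne', ENNReal.ofReal_one, one_mul,
      measure_inter_add_sdiff _ measurableSet_Ico, hSv]
  · rw [Set.disjoint_left]
    intro v h1 h2
    exact (show (v.1 : ℝ) < aMin p 1 from h1.1).not_ge h2.2

theorem isLocalCoupling_fhat (hp : IsTransitionKernel p)
    (h_lim : ∀ r < 1, ∃ k, 1 ≤ k ∧ r < aMin p k) (h_pos : 0 < aMin p 1)
    (hf : IsMaximalCoupling p f) (hfbar : IsRearrangement p f fbar) :
    IsLocalCoupling p (fhat p fbar) where
  reproduces := reproduces_fhat hp h_lim h_pos hf hfbar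
  pos w hw v := by
    have ha1 : aMin p 1 ≤ 1 := (aMin_le_aSum hp 1 hw).trans (aSum_le_one hp 1 hw)
    unfold fhat
    split_ifs with hv
    · exact rearrangement_pos hp h_lim hf hfbar hw
        ⟨mul_nonneg h_pos.le (v.2 (w 0)).2.1, mul_lt_one_of_nonneg_of_lt_one_right ha1
          (v.2 (w 0)).2.1 (v.2 (w 0)).2.2⟩
    · exact rearrangement_pos hp h_lim hf hfbar hw v.1.2
  congr k hk v hvk w hw z hz h := by
    have h0 : w 0 = z 0 := word_eq_word_iff.1 h 0 hk
    unfold fhat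
    split_ifs with hv
    · rw [← h0]
      refine rearrangement_congr hp hf hfbar hw hz le_rfl (word_one_eq_iff.2 h0)
        (mul_nonneg h_pos.le (v.2 (w 0)).2.1) (lt_of_lt_of_le ?_ (aMin_le_aSum hp 1 hw))
      exact mul_lt_of_lt_one_right h_pos (v.2 (w 0)).2.2
    · exact rearrangement_congr hp hf hfbar hw hz hk h v.1.2.1
        (hvk.trans_le (aMin_le_aSum hp k hw))
  markov := by
    rintro x h ⟨w, hw, rfl, hpos⟩
    obtain ⟨c₁, d₁, c₂, d₂, hc⟩ := hfbar
    obtain ⟨-, -, hsub, -, -, hne⟩ := (hc w hw).1 h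
    refine ⟨{u : I01 | aMin p 1 * (u : ℝ) ∈ Ico (c₁ h (w 0)) (d₁ h (w 0))},
      (measurable_subtype_coe.const_mul _) measurableSet_Ico, ?_, fun v hv hT z hz h0 => ?_⟩
    · obtain ⟨u, hu1, hu2⟩ := hne hpos
      rw [unif01_mul_mem h_pos, Ico_inter_Ico, Real.volume_Ico]
      refine mul_ne_zero (by simpa using h_pos) ?_
      simp only [ne_eq, ENNReal.ofReal_eq_zero, not_le, sub_pos]
      exact (max_le hu1.1 hu2.1).trans_lt (lt_min hu1.2 hu2.2)
    · rw [fhat, if_pos hv, h0]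
      refine ((hc z hz).2.1 _ ⟨mul_nonneg h_pos.le (v.2 (w 0)).2.1, lt_of_lt_of_le
        (mul_lt_of_lt_one_right h_pos (v.2 (w 0)).2.2) (aMin_le_aSum hp 1 hz)⟩ h).2 ?_
      rw [h0]
      exact Or.inl hT

end Modified

/-! ### The i.i.d. source of randomness -/

section Source

variable {G : Type*} [Fintype G]

theorem iidLaw_map_injective {ι κ : Type*} {e : ι → κ} (he : Function.Injective e) :
    (iidLaw G κ).map (fun u i => u (e i)) = iidLaw G ι := by
  classical
  refine Measure.eq_infinitePi _ fun s t ht => ?_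
  have hm : Measurable (fun (u : κ → Cube G) (i : ι) => u (e i)) := by fun_prop
  rw [Measure.map_apply hm (MeasurableSet.pi s.countable_toSet fun i _ => ht i)]
  have h1 : (fun (u : κ → Cube G) (i : ι) => u (e i)) ⁻¹' (Set.pi s t) =
      Set.pi (s.map ⟨e, he⟩) (fun k => {a | ∀ i, e i = k → a ∈ t i}) := by
    ext u
    simp only [mem_preimage, Set.mem_pi, Finset.coe_map, Function.Embedding.coeFn_mk,
      mem_image, mem_ofPred_eq, Finset.mem_coe]
    constructor
    · rintro h k ⟨i, hi, rfl⟩ j hj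
      rw [he hj, ← he hj, hj]
      exact he hj ▸ h i hi
    · intro h i hi
      exact h (e i) ⟨i, hi, rfl⟩ i rfl
  have h2 : ∀ i, {a : Cube G | ∀ j, e j = e i → a ∈ t j} = t i := fun i => by
    ext a
    exact ⟨fun h => h i rfl, fun h j hj => he hj ▸ h⟩
  rw [h1, iidLaw, Measure.infinitePi_pi, Finset.prod_map]
  · simp only [Function.Embedding.coeFn_mk, h2]
  · intro k hk
    obtain ⟨i, -, rfl⟩ := Finset.mem_map.1 hk
    simpa only [Function.Embedding.coeFn_mk, h2] using ht i

theorem measurable_snoc {X : Type*} [MeasurableSpace X] :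
    Measurable (fun q : X × (ℕ → X) => snoc q.1 q.2) := by
  refine measurable_pi_lambda _ fun i => ?_
  cases i with
  | zero => exact measurable_fst
  | succ i => exact (measurable_pi_apply i).comp measurable_snd

/-- Prolonging an i.i.d. sequence by an independent point yields an i.i.d. sequence. -/
theorem iidLaw_map_snoc :
    ((cubeLaw G).prod (iidLaw G ℕ)).map (fun q => snoc q.1 q.2) = iidLaw G ℕ := by
  classical
  refine Measure.eq_infinitePi _ fun s t ht => ?_
  -- it suffices to consider boxes whose constrained coordinates are `0, …, n`
  have key : ∀ (n : ℕ) (t : ℕ → Set (Cube G)), (∀ i, MeasurableSet (t i)) →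
      ((cubeLaw G).prod (iidLaw G ℕ)).map (fun q => snoc q.1 q.2)
        (Set.pi (Finset.range (n + 1)) t) = ∏ i ∈ Finset.range (n + 1), cubeLaw G (t i) := by
    intro n t ht
    rw [Measure.map_apply measurable_snoc
      (MeasurableSet.pi (Finset.countable_toSet _) fun i _ => ht i)]
    have h1 : (fun q : Cube G × (ℕ → Cube G) => snoc q.1 q.2) ⁻¹'
        (Set.pi (Finset.range (n + 1)) t) =
        t 0 ×ˢ Set.pi (Finset.range n) (fun i => t (i + 1)) := by
      ext q
      simp only [mem_preimage, Set.mem_pi, Finset.mem_coe, Finset.mem_range, mem_prod]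
      constructor
      · intro h
        exact ⟨h 0 (by omega), fun i hi => h (i + 1) (by omega)⟩
      · rintro ⟨h0, h⟩ (_ | i) hi
        · exact h0
        · exact h i (by omega)
    rw [h1, Measure.prod_prod, iidLaw, Measure.infinitePi_pi _ (fun i _ => ht (i + 1)),
      Finset.prod_range_succ', mul_comm]
  obtain ⟨n, hn⟩ : ∃ n, s ⊆ Finset.range (n + 1) :=
    ⟨s.sup id, fun i hi => Finset.mem_range.2 (Nat.lt_succ_of_le (Finset.le_sup (f := id) hi))⟩
  have h1 : Set.pi s t = Set.pi (Finset.range (n + 1)) (fun i => if i ∈ s then t i else univ) := by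
    ext u
    simp only [Set.mem_pi, Finset.mem_coe]
    constructor
    · intro h i _
      split_ifs with hi
      · exact h i hi
      · trivial
    · intro h i hi
      simpa [hi] using h i (hn hi)
  rw [h1, key n _ fun i => by split_ifs; exacts [ht i, MeasurableSet.univ],
    ← Finset.prod_subset hn (fun i _ hi => by simp [hi])]
  exact Finset.prod_congr rfl fun i hi => by simp [hi]

theorem iidLaw_peel {S : Set (Cube G)} {B : Set (ℕ → Cube G)} (hS : MeasurableSet S)
    (hB : MeasurableSet B) :
    iidLaw G ℕ {u | u 0 ∈ S ∧ (fun i => u (i + 1)) ∈ B} = cubeLaw G S * iidLaw G ℕ B := by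
  have hm : MeasurableSet {u : ℕ → Cube G | u 0 ∈ S ∧ (fun i => u (i + 1)) ∈ B} := by
    refine (measurable_pi_apply 0 hS).inter ?_
    exact (show Measurable fun (u : ℕ → Cube G) i => u (i + 1) by fun_prop) hB
  rw [← iidLaw_map_snoc, Measure.map_apply measurable_snoc hm, iidLaw_map_snoc]
  exact Measure.prod_prod S B

theorem iidLaw_box {m : ℕ} {S : ℕ → Set (Cube G)} {B : Set (ℕ → Cube G)}
    (hS : ∀ i, MeasurableSet (S i)) (hB : MeasurableSet B) :
    iidLaw G ℕ {u | (∀ i < m, u i ∈ S i) ∧ (fun i => u (i + m)) ∈ B} =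
      (∏ i ∈ Finset.range m, cubeLaw G (S i)) * iidLaw G ℕ B := by
  induction m generalizing S with
  | zero => simp [show ∀ u : ℕ → Cube G, (fun i => u i) = u from fun _ => rfl]
  | succ m ih =>
    have hm : MeasurableSet {u : ℕ → Cube G |
        (∀ i < m, u i ∈ S (i + 1)) ∧ (fun i => u (i + m)) ∈ B} := by
      refine MeasurableSet.inter (s₁ := {u : ℕ → Cube G | ∀ i < m, u i ∈ S (i + 1)}) ?_
        ((show Measurable fun (u : ℕ → Cube G) i => u (i + m) by fun_prop) hB)
      rw [show {u : ℕ → Cube G | ∀ i < m, u i ∈ S (i + 1)} =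
        ⋂ i, ⋂ (_ : i < m), (fun u => u i) ⁻¹' S (i + 1) by ext; simp]
      exact MeasurableSet.iInter fun i => MeasurableSet.iInter fun _ =>
        measurable_pi_apply i (hS (i + 1))
    have := iidLaw_peel (hS 0) hm
    rw [ih fun i => hS (i + 1)] at this
    rw [Finset.prod_range_succ', mul_comm (∏ i ∈ _, _), mul_assoc, ← this]
    congr 1
    ext u
    simp only [mem_ofPred_eq]
    constructor
    · rintro ⟨h1, h2⟩
      refine ⟨h1 0 (by omega), fun i hi => h1 (i + 1) (by omega), ?_⟩
      simpa only [add_assoc, add_comm 1 m] using h2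
    · rintro ⟨h0, h1, h2⟩
      refine ⟨?_, ?_⟩
      · rintro (_ | i) hi
        · exact h0
        · exact h1 i (by omega)
      · simpa only [add_assoc, add_comm 1 m] using h2

end Source

/-! ### Paths of equal length to a common vertex -/

section Graph

variable {G : Type*} {A : G → G → Prop}

theorem ReachIn.trans {m n : ℕ} {x y z : G} (h₁ : ReachIn A m x y) (h₂ : ReachIn A n y z) :
    ReachIn A (m + n) x z := by
  induction m generalizing x with
  | zero =>
    obtain rfl : x = y := h₁
    simpa using h₂
  | succ m ih =>
    obtain ⟨x', hx, h⟩ := h₁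
    rw [Nat.succ_add]
    exact ⟨x', hx, ih h⟩

theorem ReachIn.mem_of_closed {L : Set G} (hL : ∀ x ∈ L, ∀ y, A x y → y ∈ L) {n : ℕ} {x y : G}
    (hx : x ∈ L) (h : ReachIn A n x y) : y ∈ L := by
  induction n generalizing x with
  | zero =>
    obtain rfl : x = y := h
    exact hx
  | succ n ih =>
    obtain ⟨x', hxx', h⟩ := h
    exact ih (hL x hx x' hxx') h

/-- In a finite set of vertices which no arc leaves and in which every vertex has a successor, an
irreducible class is reachable from every vertex: take the vertices reachable from a vertex whose
reachable set is smallest. -/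
theorem exists_reachIn_irreducibleClass [Finite G] {L : Set G}
    (hL : ∀ x ∈ L, ∀ y, A x y → y ∈ L) (hsucc : ∀ x ∈ L, ∃ y, A x y) {x : G} (hx : x ∈ L) :
    ∃ C, IsIrreducibleClass A C ∧ ∃ y ∈ C, ∃ n, ReachIn A n x y := by
  let R : G → Set G := fun y => {z | ∃ n, ReachIn A n y z}
  have hself : ∀ y, y ∈ R y := fun y => ⟨0, rfl⟩
  have htrans : ∀ {y z}, z ∈ R y → R z ⊆ R y := by
    rintro y z ⟨m, hm⟩ t ⟨n, hn⟩
    exact ⟨m + n, hm.trans hn⟩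
  obtain ⟨y, hy, hmin⟩ := (R x).toFinite.exists_minimalFor (fun y => (R y).ncard) _ ⟨x, hself x⟩
  have heq : ∀ z ∈ R y, R z = R y := by
    intro z hz
    refine Set.eq_of_subset_of_ncard_le (htrans hz) ?_ (toFinite _)
    exact hmin (htrans hy hz) (ncard_le_ncard (htrans hz) (toFinite _))
  refine ⟨R y, ⟨⟨y, hself y⟩, fun z hz t ht => htrans hz ⟨1, t, ht, rfl⟩, ?_⟩, y, hself y, hy⟩
  intro z hz t ht
  obtain ⟨n, hn⟩ := hy
  obtain ⟨m, hm⟩ := hz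
  obtain ⟨z', hz'⟩ := hsucc z ((hn.trans hm).mem_of_closed hL hx)
  have h1 : z' ∈ R y := htrans ⟨m, hm⟩ ⟨1, z', hz', rfl⟩
  rw [← heq z' h1] at ht
  obtain ⟨k, hk⟩ := ht
  exact ⟨k + 1, k.succ_pos, z', hz', hk⟩

theorem IsAperiodic.exists_reachIn_self {C : Set G} (hC : IsAperiodic A C) {z : G} (hz : z ∈ C) :
    ∃ M, ∀ n ≥ M, ReachIn A n z z := by
  let S : Set ℕ := {n | 0 < n ∧ ReachIn A n z z}
  have hgcd : Nat.setGcd S = 1 :=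
    hC z hz _ fun n hn hr => Nat.setGcd_dvd_of_mem (s := S) ⟨hn, hr⟩
  obtain ⟨M, hM⟩ := Nat.exists_mem_closure_of_ge S
  refine ⟨M, fun n hn => ?_⟩
  refine AddSubmonoid.closure_induction (motive := fun n _ => ReachIn A n z z)
    (fun m hm => hm.2) rfl (fun m n _ _ h1 h2 => h1.trans h2) (hM n hn (by simp [hgcd]))

theorem exists_uniform_reachIn [Finite G] {C L : Set G}
    (hC : IsIrreducibleClass A C) (huniq : ∀ C', IsIrreducibleClass A C' → C' = C)
    (haper : IsAperiodic A C) (hL : ∀ x ∈ L, ∀ y, A x y → y ∈ L)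
    (hsucc : ∀ x ∈ L, ∃ y, A x y) :
    ∃ z, ∃ N, 0 < N ∧ ∀ x ∈ L, ReachIn A N x z := by
  obtain ⟨z, hz⟩ := hC.1
  obtain ⟨M, hM⟩ := haper.exists_reachIn_self hz
  have h1 : ∀ x, ∃ n, x ∈ L → ReachIn A n x z := by
    intro x
    by_cases hx : x ∈ L
    · obtain ⟨C', hC', y, hy, n, hn⟩ := exists_reachIn_irreducibleClass hL hsucc hx
      rw [huniq C' hC'] at hy
      obtain ⟨m, -, hm⟩ := hC.2.2 y hy z hz
      exact ⟨n + m, fun _ => hn.trans hm⟩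
    · exact ⟨0, fun h => (hx h).elim⟩
  choose n hn using h1
  obtain ⟨K, hK⟩ := (finite_range n).bddAbove
  refine ⟨z, K + M + 1, by omega, fun x hx => ?_⟩
  have hxK : n x ≤ K := hK ⟨x, rfl⟩
  have := (hn x hx).trans (hM (K + M + 1 - n x) (by omega))
  rwa [Nat.add_sub_cancel' (by omega)] at this

end Graph

/-! ### Trajectories -/

section Trajectories

variable {G : Type*} {F : Cube G → Hist G → G}

theorem traj_add (u : ℕ → Cube G) (m n : ℕ) (w : Hist G) :
    traj F u (m + n) w = traj F u m (traj F (fun i => u (i + m)) n w) := by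
  induction n generalizing w with
  | zero => rfl
  | succ n ih =>
    rw [← add_assoc]
    simp only [traj]
    rw [ih, add_comm n m]

/-- The last step of a trajectory is made with `U₀`. -/
theorem traj_succ_left (u : ℕ → Cube G) (n : ℕ) (w : Hist G) :
    traj F u (n + 1) w =
      snoc (F (u 0) (traj F (fun i => u (i + 1)) n w)) (traj F (fun i => u (i + 1)) n w) := by
  rw [add_comm, traj_add]
  rfl

theorem traj_apply_add (u : ℕ → Cube G) (m i : ℕ) (w : Hist G) : traj F u m w (m + i) = w i := by
  induction m generalizing w i with
  | zero => simp [traj]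
  | succ m ih =>
    have := ih (i + 1) (snoc (F (u m) w) w)
    rw [show m + 1 + i = m + (i + 1) by omega]
    exact this

theorem traj_apply_of_le (u : ℕ → Cube G) {j n : ℕ} (h : j ≤ n) (w : Hist G) :
    traj F u n w j = traj F (fun i => u (i + j)) (n - j) w 0 := by
  conv_lhs => rw [← Nat.add_sub_cancel' h, traj_add]
  exact traj_apply_add u j 0 _

variable [Fintype G] {p : G → Hist G → ℝ}

theorem IsLocalCoupling.snoc_mem (hF : IsLocalCoupling p F) {w : Hist G} (hw : w ∈ admissible p)
    (v : Cube G) : snoc (F v w) w ∈ admissible p :=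
  snoc_mem_admissible hw (hF.pos w hw v).ne'

theorem IsLocalCoupling.traj_mem (hF : IsLocalCoupling p F) (u : ℕ → Cube G) (n : ℕ) {w : Hist G}
    (hw : w ∈ admissible p) : traj F u n w ∈ admissible p := by
  induction n generalizing w with
  | zero => exact hw
  | succ n ih => exact ih (hF.snoc_mem hw _)

/-- Two trajectories whose last `m` letters agree stay together as long as each variable used lies
below the level that reads only the letters since the agreement. -/
theorem IsLocalCoupling.word_traj_congr (hF : IsLocalCoupling p F) (u : ℕ → Cube G) (s : ℕ) {m : ℕ}
    (hm : 1 ≤ m) {w z : Hist G} (hw : w ∈ admissible p) (hz : z ∈ admissible p)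
    (h : word w m = word z m) (hu : ∀ t < s, ((u t).1 : ℝ) < aMin p (m + (s - 1 - t))) :
    word (traj F u s w) (m + s) = word (traj F u s z) (m + s) := by
  induction s generalizing m w z with
  | zero => exact h
  | succ s ih =>
    have hs : F (u s) w = F (u s) z :=
      hF.congr m hm _ (by simpa using hu s s.lt_succ_self) w hw z hz h
    have := ih (m := m + 1) (by omega) (hF.snoc_mem hw (u s)) (hF.snoc_mem hz (u s))
      (by rw [word_snoc, word_snoc, h, hs]) (fun t ht => by
        have := hu t (by omega)
        rwa [show m + (s + 1 - 1 - t) = m + 1 + (s - 1 - t) by omega] at this)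
    rw [show m + (s + 1) = m + 1 + s by omega]
    exact this

end Trajectories

/-! ### Coalescence in the Markov regime -/

section Block

theorem unif01_lt (r : ℝ) : unif01 {a : I01 | (a : ℝ) < r} = ENNReal.ofReal (min 1 r) := by
  rw [show {a : I01 | (a : ℝ) < r} = Subtype.val ⁻¹' Iio r from rfl, unif01_apply, inter_comm,
    Ico_inter_Iio, Real.volume_Ico, sub_zero]

variable {G : Type*} [Fintype G] [MeasurableSpace G] {p : G → Hist G → ℝ}
  {F : Cube G → Hist G → G}

/-- With positive probability, `N` consecutive variables lie in the Markov regime and lead every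
trajectory to the same state `z`: every letter of an admissible history is joined to `z` by a path of
length `N`, and the variable used `j` steps before the end (which lies in `D j`) moves each letter
joined to `z` by a path of length `j + 1` to a letter joined to `z` by a path of length `j`. -/
theorem IsLocalCoupling.exists_block (hp : IsTransitionKernel p) (hF : IsLocalCoupling p F)
    (h_pos : 0 < aMin p 1) {A : G → G → Prop}
    (hA : ∀ w ∈ admissible p, ∀ g, A (w 0) g ↔ 0 < aLetter p 1 g w)
    {C : Set G} (hC : IsIrreducibleClass A C) (huniq : ∀ C', IsIrreducibleClass A C' → C' = C)
    (haper : IsAperiodic A C) :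
    ∃ N, 0 < N ∧ ∃ D : ℕ → Set (Cube G), (∀ i, MeasurableSet (D i)) ∧
      (∀ i, cubeLaw G (D i) ≠ 0) ∧ ∀ u : ℕ → Cube G, (∀ i < N, u i ∈ D i) →
        ∀ w ∈ admissible p, ∀ z ∈ admissible p, traj F u N w 0 = traj F u N z 0 := by
  obtain ⟨z, N, hN, hreach⟩ := exists_uniform_reachIn (L := {x | ∃ w ∈ admissible p, w 0 = x})
    hC huniq haper
    (by
      rintro _ ⟨w, hw, rfl⟩ y hy
      have := ((hA w hw y).1 hy).trans_le (aLetter_le hp 1 y hw)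
      exact ⟨snoc y w, snoc_mem_admissible hw this.ne', rfl⟩)
    (by
      rintro _ ⟨w, hw, rfl⟩
      by_contra! hcon
      refine (h_pos.trans_le (aMin_le_aSum hp 1 hw)).not_ge (Finset.sum_nonpos fun g _ => ?_)
      exact not_lt.1 fun h => hcon g ((hA w hw g).2 h))
  have hT : ∀ (n : ℕ) (x : G), ∃ T : Set I01, MeasurableSet T ∧ unif01 T ≠ 0 ∧
      ∀ v : Cube G, (v.1 : ℝ) < aMin p 1 → v.2 x ∈ T → ∀ w ∈ admissible p, w 0 = x →
        ReachIn A (n + 1) x z → ReachIn A n (F v w) z := by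
    intro n x
    by_cases h : (∃ w ∈ admissible p, w 0 = x) ∧ ReachIn A (n + 1) x z
    · obtain ⟨⟨w, hw, rfl⟩, y, hy, hyz⟩ := h
      obtain ⟨T, hTm, hT0, hT⟩ := hF.markov (w 0) y ⟨w, hw, rfl, (hA w hw y).1 hy⟩
      refine ⟨T, hTm, hT0, fun v hv hvT w' hw' h0 _ => ?_⟩
      rwa [hT v hv hvT w' hw' h0]
    · refine ⟨univ, MeasurableSet.univ, by simp, fun v _ _ w hw h0 hr => ?_⟩
      exact (h ⟨⟨w, hw, h0⟩, hr⟩).elim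
  choose T hTm hT0 hT using hT
  refine ⟨N, hN, fun n => {a : I01 | (a : ℝ) < aMin p 1} ×ˢ Set.pi univ (T n), fun n => ?_,
    fun n => ?_, fun u hu => ?_⟩
  · exact (measurableSet_lt measurable_subtype_coe measurable_const).prod
      (MeasurableSet.univ_pi (hTm n))
  · rw [cubeLaw, Measure.prod_prod, Measure.pi_pi]
    refine mul_ne_zero ?_ (Finset.prod_ne_zero_iff.2 fun x _ => hT0 n x)
    rw [unif01_lt]
    simpa using h_pos
  · have key : ∀ n ≤ N, ∀ w ∈ admissible p, ReachIn A n (w 0) z → traj F u n w 0 = z := by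
      intro n
      induction n with
      | zero => exact fun _ w _ h => h
      | succ n ih =>
        intro hn w hw h
        refine ih (by omega) _ (hF.snoc_mem hw (u n)) ?_
        have := hu n (by omega)
        exact hT n (w 0) (u n) this.1 (this.2 (w 0) (mem_univ _)) w hw rfl h
    intro w hw w' hw'
    rw [key N le_rfl w hw (hreach _ ⟨w, hw, rfl⟩), key N le_rfl w' hw' (hreach _ ⟨w', hw', rfl⟩)]

end Block

/-! ### The backward coalescence time -/

section Time

variable {G : Type*}

/-- Coalescence takes place at time `-s`: the block of `N` variables ending at `-s` lies in the
coalescing sets `D i`, and each later variable `U₋ₜ` lies below `aₛ₋ₜ`, so that it only reads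
letters produced since time `-s`. -/
def GoodAt (a : ℕ → ℝ) (N : ℕ) (D : ℕ → Set (Cube G)) (u : ℕ → Cube G) (s : ℕ) : Prop :=
  (∀ t < s, ((u t).1 : ℝ) < a (s - t)) ∧ ∀ i < N, u (i + s) ∈ D i

open Classical in
/-- The first time, backward, at which a block of variables ensuring coalescence is completed. -/
noncomputable def coalescenceTime (a : ℕ → ℝ) (N : ℕ) (D : ℕ → Set (Cube G)) (u : ℕ → Cube G) :
    WithTop ℕ :=
  if h : ∃ s, GoodAt a N D u s then ((Nat.find h + N - 1 : ℕ) : WithTop ℕ) else ⊤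

variable {a : ℕ → ℝ} {N : ℕ} {D : ℕ → Set (Cube G)}

/-- The constraint that `GoodAt` puts on the variable `U₋ᵢ`. -/
def goodBox (a : ℕ → ℝ) (D : ℕ → Set (Cube G)) (s i : ℕ) : Set (Cube G) :=
  if i < s then {v | (v.1 : ℝ) < a (s - i)} else D (i - s)

theorem goodAt_iff {u : ℕ → Cube G} {s : ℕ} :
    GoodAt a N D u s ↔ ∀ i < s + N, u i ∈ goodBox a D s i := by
  constructor
  · rintro ⟨h1, h2⟩ i hi
    by_cases his : i < s
    · simpa [goodBox, his] using h1 i his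
    · have := h2 (i - s) (by omega)
      rw [Nat.sub_add_cancel (by omega)] at this
      simpa [goodBox, his] using this
  · intro h
    refine ⟨fun t ht => ?_, fun i hi => ?_⟩
    · simpa [goodBox, ht] using h t (by omega)
    · simpa [goodBox] using h (i + s) (by omega)

theorem coalescenceTime_le_iff {u : ℕ → Cube G} {l : ℕ} (hN : 0 < N) :
    coalescenceTime a N D u ≤ l ↔ ∃ s, s + N - 1 ≤ l ∧ GoodAt a N D u s := by
  classical
  unfold coalescenceTime
  split_ifs with h
  · rw [Nat.cast_le]
    constructor
    · intro hl
      exact ⟨Nat.find h, hl, Nat.find_spec h⟩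
    · rintro ⟨s, hs, hg⟩
      have := Nat.find_min' h hg
      omega
  · constructor
    · intro hl
      simp at hl
    · rintro ⟨s, -, hg⟩
      exact (h ⟨s, hg⟩).elim

theorem coalescenceTime_eq {u : ℕ → Cube G} {l : ℕ} (hN : 0 < N)
    (h : coalescenceTime a N D u = l) : ∃ s, s + N = l + 1 ∧ GoodAt a N D u s := by
  classical
  unfold coalescenceTime at h
  split_ifs at h with hex
  · rw [Nat.cast_inj] at h
    exact ⟨Nat.find hex, by omega, Nat.find_spec hex⟩
  · exact (WithTop.top_ne_natCast l h).elim

theorem measurableSet_goodBox (hD : ∀ i, MeasurableSet (D i)) (s i : ℕ) :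
    MeasurableSet (goodBox a D s i) := by
  unfold goodBox
  split_ifs
  · exact measurableSet_lt (measurable_subtype_coe.comp measurable_fst) measurable_const
  · exact hD _

theorem measurable_piLE_apply {i l : ℕ} (h : i ≤ l) :
    Measurable[Filtration.piLE (X := fun _ : ℕ => Cube G) l] fun u : ℕ → Cube G => u i := by
  have : Measurable fun x : (∀ _ : Set.Iic l, Cube G) => x ⟨i, h⟩ := measurable_pi_apply _
  exact this.comp (comap_measurable _)

theorem measurableSet_goodAt {Ω : Type*} [MeasurableSpace Ω] (hD : ∀ i, MeasurableSet (D i)) {s : ℕ}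
    {U : Ω → ℕ → Cube G} (hU : ∀ i < s + N, Measurable fun ω => U ω i) :
    MeasurableSet {ω | GoodAt a N D (U ω) s} := by
  rw [show {ω | GoodAt a N D (U ω) s} =
    ⋂ i, ⋂ (_ : i < s + N), (fun ω => U ω i) ⁻¹' goodBox a D s i by ext; simp [goodAt_iff]]
  exact MeasurableSet.iInter fun i => MeasurableSet.iInter fun hi =>
    hU i hi (measurableSet_goodBox hD s i)

theorem isStoppingTime_coalescenceTime (hN : 0 < N) (hD : ∀ i, MeasurableSet (D i)) :
    IsStoppingTime (Filtration.piLE (X := fun _ : ℕ => Cube G)) (coalescenceTime a N D) := by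
  intro l
  have : {u : ℕ → Cube G | coalescenceTime a N D u ≤ l} =
      ⋃ s, ⋃ (_ : s + N - 1 ≤ l), {u | GoodAt a N D u s} := by
    ext u
    simp only [mem_ofPred_eq, coalescenceTime_le_iff hN, mem_iUnion, exists_prop]
  change MeasurableSet[Filtration.piLE (X := fun _ : ℕ => Cube G) l]
    {u : ℕ → Cube G | coalescenceTime a N D u ≤ ((l : ℕ) : WithTop ℕ)}
  rw [this]
  let m := Filtration.piLE (X := fun _ : ℕ => Cube G) l
  refine @MeasurableSet.iUnion _ _ m _ _ fun s => @MeasurableSet.iUnion _ _ m _ _ fun hs => ?_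
  exact @measurableSet_goodAt _ _ _ _ _ m hD _ _ fun i hi => measurable_piLE_apply (by omega)

variable [Fintype G]

theorem cubeLaw_fst_lt {r : ℝ} (hr : r ≤ 1) :
    cubeLaw G {v | (v.1 : ℝ) < r} = ENNReal.ofReal r := by
  rw [show {v : Cube G | (v.1 : ℝ) < r} = {v | v.1 ∈ {a : I01 | (a : ℝ) < r}} from rfl,
    cubeLaw_fst, unif01_lt, min_eq_right hr]

theorem prod_goodBox (ha0 : ∀ m, 0 ≤ a m) (ha1 : ∀ m, a m ≤ 1) (s : ℕ) :
    ∏ i ∈ Finset.range (s + N), cubeLaw G (goodBox a D s i) =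
      ENNReal.ofReal (∏ m ∈ Finset.Icc 1 s, a m) * ∏ i ∈ Finset.range N, cubeLaw G (D i) := by
  rw [Finset.prod_range_add]
  congr 1
  · rw [ENNReal.ofReal_prod_of_nonneg fun m _ => ha0 m]
    have h1 : ∀ i ∈ Finset.range s, cubeLaw G (goodBox a D s i) = ENNReal.ofReal (a (s - i)) := by
      intro i hi
      rw [goodBox, if_pos (Finset.mem_range.1 hi), cubeLaw_fst_lt (ha1 _)]
    rw [Finset.prod_congr rfl h1]
    refine Finset.prod_bij' (fun i _ => s - i) (fun m _ => s - m) ?_ ?_ ?_ ?_ ?_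
    · intro i hi
      simp only [Finset.mem_range, Finset.mem_Icc] at hi ⊢
      omega
    · intro i hi
      simp only [Finset.mem_range, Finset.mem_Icc] at hi ⊢
      omega
    · intro i hi
      simp only [Finset.mem_range] at hi
      omega
    · intro i hi
      simp only [Finset.mem_Icc] at hi
      omega
    · exact fun _ _ => rfl
  · exact Finset.prod_congr rfl fun i _ => by simp [goodBox]

/-- Almost surely, coalescence takes place at some time. If `c` is the probability that it does not,
then the event that it takes place at `-s` while the variables before that block admit no such time
has probability `(∏_{m ≤ s} aₘ) δ c`, where `δ > 0` is the probability of a coalescing block. At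
most `N` of these events occur together, so divergence of `∑ₛ ∏_{m ≤ s} aₘ` forces `c = 0`. -/
theorem ae_exists_goodAt (ha0 : ∀ m, 0 ≤ a m) (ha1 : ∀ m, a m ≤ 1)
    (h_div : Tendsto (fun n : ℕ => ∑ s ∈ Finset.Icc 1 n, ∏ m ∈ Finset.Icc 1 s, a m) atTop atTop)
    (hD : ∀ i, MeasurableSet (D i)) (hD0 : ∀ i, cubeLaw G (D i) ≠ 0) :
    ∀ᵐ u ∂(iidLaw G ℕ), ∃ s, GoodAt a N D u s := by
  classical
  have hgm : ∀ s, MeasurableSet {u : ℕ → Cube G | GoodAt a N D u s} := fun s =>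
    measurableSet_goodAt hD fun i _ => measurable_pi_apply i
  let B : Set (ℕ → Cube G) := {u | ¬ ∃ s, GoodAt a N D u s}
  have hB : MeasurableSet B := by
    rw [show B = ⋂ s, {u : ℕ → Cube G | GoodAt a N D u s}ᶜ by ext; simp [B]]
    exact MeasurableSet.iInter fun s => (hgm s).compl
  -- `s` is good, and the variables preceding its block admit no good time
  let E : ℕ → Set (ℕ → Cube G) := fun s =>
    {u | (∀ i < s + N, u i ∈ goodBox a D s i) ∧ (fun i => u (i + (s + N))) ∈ B}
  have hEm : ∀ s, MeasurableSet (E s) := by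
    intro s
    have h1 := hgm s
    simp only [goodAt_iff] at h1
    exact h1.inter ((show Measurable fun (u : ℕ → Cube G) i => u (i + (s + N)) by fun_prop) hB)
  have hEP : ∀ s, iidLaw G ℕ (E s) = ENNReal.ofReal (∏ m ∈ Finset.Icc 1 s, a m) *
      ((∏ i ∈ Finset.range N, cubeLaw G (D i)) * iidLaw G ℕ B) := by
    intro s
    rw [← mul_assoc, ← prod_goodBox ha0 ha1]
    exact iidLaw_box (measurableSet_goodBox hD s) hB
  -- a good time beyond the block of `s` would be good for the variables preceding that block
  have hclose : ∀ u s s', u ∈ E s → u ∈ E s' → s' < s + N := by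
    intro u s s' hs hs'
    by_contra! hcon
    have hg := goodAt_iff.2 hs'.1
    refine hs.2 ⟨s' - (s + N), fun t ht => ?_, fun i hi => ?_⟩
    · have := hg.1 (t + (s + N)) (by omega)
      rwa [show s' - (t + (s + N)) = s' - (s + N) - t by omega] at this
    · have := hg.2 i hi
      rwa [show i + s' = i + (s' - (s + N)) + (s + N) by omega] at this
  have hcount : ∀ (n : ℕ) u, ∑ s ∈ Finset.Icc 1 n, (E s).indicator (1 : (ℕ → Cube G) → ENNReal) u ≤ N := by
    intro n u
    have h1 : ∑ s ∈ Finset.Icc 1 n, (E s).indicator (1 : (ℕ → Cube G) → ENNReal) u =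
        (((Finset.Icc 1 n).filter fun s => u ∈ E s).card : ENNReal) := by
      rw [Finset.card_filter]
      push_cast
      exact Finset.sum_congr rfl fun s _ => by simp [Set.indicator_apply]
    rw [h1, Nat.cast_le]
    rcases ((Finset.Icc 1 n).filter fun s => u ∈ E s).eq_empty_or_nonempty with h | h
    · simp [h]
    · have hmin := Finset.mem_filter.1 (Finset.min'_mem _ h)
      calc _ ≤ (Finset.Ico (Finset.min' _ h) (Finset.min' _ h + N)).card := by
            refine Finset.card_le_card fun s hs => Finset.mem_Ico.2 ⟨Finset.min'_le _ s hs, ?_⟩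
            exact hclose u _ s hmin.2 (Finset.mem_filter.1 hs).2
        _ = N := by simp
  have hsum : ∀ n : ℕ, ENNReal.ofReal (∑ s ∈ Finset.Icc 1 n, ∏ m ∈ Finset.Icc 1 s, a m) *
      ((∏ i ∈ Finset.range N, cubeLaw G (D i)) * iidLaw G ℕ B) ≤ N := by
    intro n
    rw [ENNReal.ofReal_sum_of_nonneg fun s _ => Finset.prod_nonneg fun m _ => ha0 m,
      Finset.sum_mul]
    calc _ = ∑ s ∈ Finset.Icc 1 n, ∫⁻ u, (E s).indicator 1 u ∂(iidLaw G ℕ) :=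
          Finset.sum_congr rfl fun s _ => by rw [lintegral_indicator_one (hEm s), hEP]
      _ = ∫⁻ u, ∑ s ∈ Finset.Icc 1 n, (E s).indicator 1 u ∂(iidLaw G ℕ) :=
          (lintegral_finsetSum _ fun s _ => measurable_one.indicator (hEm s)).symm
      _ ≤ ∫⁻ _, N ∂(iidLaw G ℕ) := lintegral_mono (hcount n)
      _ = N := by simp
  rw [ae_iff]
  change iidLaw G ℕ B = 0
  by_contra hB0
  have hK0 : (∏ i ∈ Finset.range N, cubeLaw G (D i)) * iidLaw G ℕ B ≠ 0 :=
    mul_ne_zero (Finset.prod_ne_zero_iff.2 fun i _ => hD0 i) hB0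
  set K := (∏ i ∈ Finset.range N, cubeLaw G (D i)) * iidLaw G ℕ B
  have hKN : (N : ENNReal) / K ≠ ⊤ := ENNReal.div_ne_top (ENNReal.natCast_ne_top N) hK0
  have hKt : K ≠ ⊤ := ENNReal.mul_ne_top
    (ENNReal.prod_ne_top fun i _ => measure_ne_top _ _) (measure_ne_top _ _)
  obtain ⟨n, hn⟩ := (h_div.eventually_gt_atTop ((N : ENNReal) / K).toReal).exists
  have h1 := (ENNReal.le_div_iff_mul_le (Or.inl hK0) (Or.inl hKt)).2 (hsum n)
  exact hn.not_ge ((ENNReal.ofReal_le_iff_le_toReal hKN).1 h1)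

variable [MeasurableSpace G] {p : G → Hist G → ℝ} {F : Cube G → Hist G → G}

theorem IsLocalCoupling.isBackwardCoalescenceTime [Nonempty G] (hp : IsTransitionKernel p)
    (hF : IsLocalCoupling p F)
    (h_div : Tendsto (fun N : ℕ => ∑ n ∈ Finset.Icc 1 N, ∏ m ∈ Finset.Icc 1 n, aMin p m)
      atTop atTop)
    (hN : 0 < N) (hD : ∀ i, MeasurableSet (D i)) (hD0 : ∀ i, cubeLaw G (D i) ≠ 0)
    (hcoal : ∀ u : ℕ → Cube G, (∀ i < N, u i ∈ D i) →
        ∀ w ∈ admissible p, ∀ z ∈ admissible p, traj F u N w 0 = traj F u N z 0) :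
    IsBackwardCoalescenceTime p F (coalescenceTime (aMin p) N D) where
  stopping := isStoppingTime_coalescenceTime hN hD
  finite := by
    obtain ⟨w, hw⟩ := admissible_nonempty hp
    filter_upwards [ae_exists_goodAt (N := N) (fun m => aMin_nonneg hp m)
      (fun m => (aMin_le_aSum hp m hw).trans (aSum_le_one hp m hw)) h_div hD hD0] with u hu
    rw [coalescenceTime, dif_pos hu]
    exact WithTop.coe_ne_top
  coalescence u l hl w hw z hz := by
    obtain ⟨s, hs, h1, h2⟩ := coalescenceTime_eq hN hl
    rw [← hs, traj_add, traj_add]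
    have := hF.word_traj_congr u s le_rfl (hF.traj_mem (fun i => u (i + s)) N hw)
      (hF.traj_mem (fun i => u (i + s)) N hz) (word_one_eq_iff.2 (hcoal _ h2 w hw z hz))
      (fun t ht => by
        rw [show 1 + (s - 1 - t) = s - t by omega]
        exact h1 t ht)
    exact word_eq_word_iff.1 this 0 (by omega)

end Time

/-! ### The simulated state and the simulated past -/

section Simulation

variable {G : Type*}

/-- The state at time `0` obtained by starting from `g₀` at the backward coalescence time, as a
function of `U₀, U₋₁, …`. -/
noncomputable def simState (F : Cube G → Hist G → G) (τ : (ℕ → Cube G) → WithTop ℕ) (g₀ : Hist G)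
    (v : ℕ → Cube G) : G :=
  traj F v ((τ v).untopD 0 + 1) g₀ 0

/-- The simulated states at times `0, -1, -2, …`. -/
noncomputable def simHist (F : Cube G → Hist G → G) (τ : (ℕ → Cube G) → WithTop ℕ) (g₀ : Hist G)
    (v : ℕ → Cube G) : Hist G :=
  fun i => simState F τ g₀ fun j => v (j + i)

theorem past_simulated (F : Cube G → Hist G → G) (τ : (ℕ → Cube G) → WithTop ℕ) (g₀ : Hist G)
    (u : ℤ → Cube G) (m : ℤ) :
    past m (simulated F τ g₀ u) = simHist F τ g₀ (fun i : ℕ => u (m - 1 - i)) := by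
  funext i
  have : (fun j : ℕ => u (m - 1 - i - j)) = fun j : ℕ => u (m - 1 - ((j + i : ℕ) : ℤ)) := by
    funext j
    congr 1
    push_cast
    ring
  change simState F τ g₀ (fun j : ℕ => u (m - 1 - i - j)) = _
  rw [this]
  rfl

variable [Fintype G] {p : G → Hist G → ℝ} {F : Cube G → Hist G → G}
  {τ : (ℕ → Cube G) → WithTop ℕ} {g₀ : Hist G}

theorem measurePreserving_shift (k : ℕ) :
    MeasurePreserving (fun (v : ℕ → Cube G) j => v (j + k)) (iidLaw G ℕ) (iidLaw G ℕ) :=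
  ⟨by fun_prop, iidLaw_map_injective (add_left_injective k)⟩

theorem measurePreserving_back (m : ℤ) :
    MeasurePreserving (fun (u : ℤ → Cube G) (i : ℕ) => u (m - i)) (iidLaw G ℤ) (iidLaw G ℕ) :=
  ⟨by fun_prop, iidLaw_map_injective fun i j h => by simpa using h⟩

theorem measurePreserving_snoc :
    MeasurePreserving (fun q : (ℕ → Cube G) × Cube G => snoc q.2 q.1)
      ((iidLaw G ℕ).prod (cubeLaw G)) (iidLaw G ℕ) := by
  refine ⟨measurable_snoc.comp measurable_swap, ?_⟩
  refine Eq.trans ?_ iidLaw_map_snoc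
  rw [← Measure.prod_swap (μ := cubeLaw G)]
  exact Measure.map_map (g := fun q : (ℕ → Cube G) × Cube G => snoc q.2 q.1)
    (measurable_snoc.comp measurable_swap) measurable_swap

theorem IsBackwardCoalescenceTime.ae_shift_ne_top (hτ : IsBackwardCoalescenceTime p F τ) :
    ∀ᵐ v ∂(iidLaw G ℕ), ∀ i, τ (fun j => v (j + i)) ≠ ⊤ :=
  ae_all_iff.2 fun i => (measurePreserving_shift i).quasiMeasurePreserving.ae hτ.finite

/-- Started from any admissible history before the backward coalescence time, the trajectory is in
the simulated state at time `0`. -/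
theorem IsBackwardCoalescenceTime.traj_eq_simState (hτ : IsBackwardCoalescenceTime p F τ)
    (hF : IsLocalCoupling p F) (hg₀ : g₀ ∈ admissible p) {v : ℕ → Cube G} {l n : ℕ}
    (hl : τ v ≤ l) (hn : l + 1 ≤ n) {w : Hist G} (hw : w ∈ admissible p) :
    traj F v n w 0 = simState F τ g₀ v := by
  obtain ⟨k, hk⟩ : ∃ k : ℕ, τ v = (k : WithTop ℕ) := by
    obtain ⟨k, hk⟩ := WithTop.ne_top_iff_exists.1 (ne_top_of_le_ne_top (WithTop.natCast_ne_top l) hl)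
    exact ⟨k, hk.symm⟩
  have hkl : k ≤ l := by
    rw [hk] at hl
    exact_mod_cast hl
  have h1 : (τ v).untopD 0 = k := by rw [hk]; rfl
  rw [simState, h1, show n = k + 1 + (n - (k + 1)) by omega, traj_add]
  exact hτ.coalescence v k hk _ (hF.traj_mem _ _ hw) _ hg₀

theorem IsBackwardCoalescenceTime.traj_eq_simHist (hτ : IsBackwardCoalescenceTime p F τ)
    (hF : IsLocalCoupling p F) (hg₀ : g₀ ∈ admissible p) {v : ℕ → Cube G} {K l n : ℕ}
    (hl : ∀ j < K, τ (fun i => v (i + j)) ≤ l) (hn : l + K ≤ n) {w : Hist G}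
    (hw : w ∈ admissible p) : word (traj F v n w) K = word (simHist F τ g₀ v) K := by
  refine word_eq_word_iff.2 fun j hj => ?_
  rw [traj_apply_of_le v (by omega)]
  exact hτ.traj_eq_simState hF hg₀ (hl j hj) (by omega) hw

theorem exists_natCast_ge {f : ℕ → WithTop ℕ} (hf : ∀ j, f j ≠ ⊤) (K : ℕ) :
    ∃ l : ℕ, ∀ j < K, f j ≤ l := by
  choose k hk using fun j => WithTop.ne_top_iff_exists.1 (hf j)
  refine ⟨∑ j ∈ Finset.range K, k j, fun j hj => ?_⟩
  rw [← hk j]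
  exact (Nat.cast_le (α := WithTop ℕ)).2 <| Finset.single_le_sum (f := k) (fun _ _ => Nat.zero_le _) (Finset.mem_range.2 hj)

theorem IsBackwardCoalescenceTime.simHist_mem (hτ : IsBackwardCoalescenceTime p F τ)
    (hF : IsLocalCoupling p F) (hg₀ : g₀ ∈ admissible p) {v : ℕ → Cube G}
    (hv : ∀ i, τ (fun j => v (j + i)) ≠ ⊤) : simHist F τ g₀ v ∈ admissible p := by
  intro K
  obtain ⟨l, hl⟩ := exists_natCast_ge hv K
  rw [← hτ.traj_eq_simHist hF hg₀ hl le_rfl hg₀]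
  exact hF.traj_mem v _ hg₀ K

/-- The simulated process is driven by `F`: the variable used at time `0` reads only finitely many
letters of the past, and these have coalesced in a trajectory started early enough. -/
theorem IsBackwardCoalescenceTime.simState_eq (hτ : IsBackwardCoalescenceTime p F τ)
    (hF : IsLocalCoupling p F) (h_lim : ∀ r < 1, ∃ k, 1 ≤ k ∧ r < aMin p k)
    (hg₀ : g₀ ∈ admissible p) {v : ℕ → Cube G} (hv : ∀ i, τ (fun j => v (j + i)) ≠ ⊤) :
    simState F τ g₀ v = F (v 0) (simHist F τ g₀ fun i => v (i + 1)) := by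
  obtain ⟨k, hk, hvk⟩ := h_lim (v 0).1 (v 0).1.2.2
  have hv' : ∀ i, τ (fun j => v (j + i + 1)) ≠ ⊤ := fun i => by
    simpa only [add_assoc] using hv (i + 1)
  obtain ⟨l, hl⟩ := exists_natCast_ge hv' k
  obtain ⟨l₀, hl₀⟩ := exists_natCast_ge hv 1
  rw [← hτ.traj_eq_simState (v := v) hF hg₀ (hl₀ 0 one_pos) (n := l₀ + l + k + 1) (by omega) hg₀,
    traj_succ_left, snoc_zero]
  exact hF.congr k hk _ hvk _ (hF.traj_mem _ _ hg₀) _ (hτ.simHist_mem hF hg₀ hv')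
    (hτ.traj_eq_simHist hF hg₀ hl (by omega) hg₀)

theorem IsBackwardCoalescenceTime.measurableSet_le (hτ : IsBackwardCoalescenceTime p F τ) (l : ℕ) :
    MeasurableSet {v | τ v ≤ l} :=
  Filtration.piLE.le l _ (hτ.stopping l)

variable [MeasurableSpace G]

theorem IsLocalCoupling.measurable_traj (hF : IsLocalCoupling p F) (n : ℕ) {w : Hist G}
    (hw : w ∈ admissible p) : Measurable fun u => traj F u n w := by
  induction n generalizing w with
  | zero => exact measurable_const
  | succ n ih =>
    intro S hS
    have : (fun u => traj F u (n + 1) w) ⁻¹' S =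
        ⋃ g, {u | F (u n) w = g ∧ traj F u n (snoc g w) ∈ S} := by
      ext u
      simp [traj]
    rw [this]
    refine MeasurableSet.iUnion fun g => ?_
    by_cases hg : p g w = 0
    · convert MeasurableSet.empty
      refine eq_empty_of_forall_notMem ?_
      rintro u ⟨rfl, -⟩
      exact (hF.pos w hw (u n)).ne' hg
    · exact ((measurable_pi_apply n) (hF.reproduces w hw g).1).inter
        (ih (snoc_mem_admissible hw hg) hS)

variable [MeasurableSingletonClass G]

theorem IsBackwardCoalescenceTime.measurable_simState (hτ : IsBackwardCoalescenceTime p F τ)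
    (hF : IsLocalCoupling p F) (hg₀ : g₀ ∈ admissible p) : Measurable (simState F τ g₀) := by
  have h1 : Measurable fun v => (τ v).untopD 0 := by
    refine measurable_of_Iic fun l => ?_
    have : (fun v => (τ v).untopD 0) ⁻¹' Iic l =
        {v | τ v ≤ l} ∪ ⋂ k : ℕ, {v | τ v ≤ k}ᶜ := by
      ext v
      simp only [mem_preimage, mem_Iic, mem_union, mem_ofPred_eq, mem_iInter, mem_compl_iff]
      cases h : τ v with
      | top => simp
      | coe k =>
        rw [WithTop.untopD_coe]
        constructor
        · exact fun hk => Or.inl ((Nat.cast_le (α := WithTop ℕ)).2 hk)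
        · rintro (hk | hk)
          · exact (Nat.cast_le (α := WithTop ℕ)).1 hk
          · exact (hk k le_rfl).elim
    rw [this]
    exact (hτ.measurableSet_le l).union
      (MeasurableSet.iInter fun k => (hτ.measurableSet_le k).compl)
  refine measurable_to_countable' fun g => ?_
  have : simState F τ g₀ ⁻¹' {g} =
      ⋃ l : ℕ, {v | (τ v).untopD 0 = l} ∩ {v | traj F v (l + 1) g₀ 0 = g} := by
    ext v
    simp [simState]
  rw [this]
  exact MeasurableSet.iUnion fun l => (h1 (measurableSet_singleton l)).inter
    ((measurable_pi_apply 0).comp (hF.measurable_traj (l + 1) hg₀) (measurableSet_singleton g))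

theorem IsBackwardCoalescenceTime.measurable_simHist (hτ : IsBackwardCoalescenceTime p F τ)
    (hF : IsLocalCoupling p F) (hg₀ : g₀ ∈ admissible p) : Measurable (simHist F τ g₀) :=
  measurable_pi_lambda _ fun i => (hτ.measurable_simState hF hg₀).comp (by fun_prop)

theorem IsBackwardCoalescenceTime.measurable_simulated (hτ : IsBackwardCoalescenceTime p F τ)
    (hF : IsLocalCoupling p F) (hg₀ : g₀ ∈ admissible p) : Measurable (simulated F τ g₀) :=
  measurable_pi_lambda _ fun n => (hτ.measurable_simState hF hg₀).comp
    (measurePreserving_back n).measurable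

theorem IsBackwardCoalescenceTime.isStationaryLaw (hτ : IsBackwardCoalescenceTime p F τ)
    (hF : IsLocalCoupling p F) (hg₀ : g₀ ∈ admissible p) :
    IsStationaryLaw ((iidLaw G ℤ).map (simulated F τ g₀)) := by
  have hX := hτ.measurable_simulated hF hg₀
  have hθ : Measurable fun (u : ℤ → Cube G) n => u (n + 1) := by fun_prop
  rw [IsStationaryLaw, Measure.map_map (by fun_prop) hX]
  have : (fun (x : ℤ → G) n => x (n + 1)) ∘ simulated F τ g₀ =
      simulated F τ g₀ ∘ fun (u : ℤ → Cube G) n => u (n + 1) := by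
    funext u n
    simp only [Function.comp_apply, simulated, add_sub_right_comm]
  rw [this, ← Measure.map_map hX hθ, iidLaw_map_injective (add_left_injective (1 : ℤ))]

end Simulation

/-! ### Compatible processes -/

section Compatible

variable {G : Type*}

theorem past_succ (m : ℤ) (x : ℤ → G) : past (m + 1) x = snoc (x m) (past m x) := by
  funext i
  cases i with
  | zero => simp [past]
  | succ i =>
    rw [snoc_succ, past, past]
    congr 1
    push_cast
    ring

variable [MeasurableSpace G]

theorem measurable_snoc_left (g : G) : Measurable (snoc g : Hist G → Hist G) :=
  measurable_snoc.comp measurable_prodMk_left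

theorem measurable_past (m : ℤ) : Measurable (past m : (ℤ → G) → Hist G) :=
  measurable_pi_lambda _ fun _ => measurable_pi_apply _

theorem measurableSet_eval_eq [MeasurableSingletonClass G] (m : ℤ) (g : G) :
    MeasurableSet {x : ℤ → G | x m = g} :=
  (measurableSet_singleton g).preimage (measurable_pi_apply m)

variable [Fintype G] {p : G → Hist G → ℝ}

theorem IsTransitionKernel.le_one (hp : IsTransitionKernel p) (g : G) (w : Hist G) :
    p g w ≤ 1 := by
  rw [← hp.sum_eq_one w]
  exact Finset.single_le_sum (fun h _ => hp.nonneg h w) (Finset.mem_univ g)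

theorem IsTransitionKernel.integrable_past (hp : IsTransitionKernel p) (μ : Measure (ℤ → G))
    [IsFiniteMeasure μ] (m : ℤ) (g : G) : Integrable (fun x => p g (past m x)) μ := by
  refine Integrable.of_bound ((hp.measurable g).comp (measurable_past m)).aestronglyMeasurable 1
    (Eventually.of_forall fun x => ?_)
  rw [Real.norm_eq_abs, abs_of_nonneg (hp.nonneg g _)]
  exact hp.le_one g _

/-- One step of the chain, acting on functions of the history. -/
noncomputable def transition (p : G → Hist G → ℝ) (h : Hist G → ENNReal) (w : Hist G) : ENNReal :=
  ∑ g, ENNReal.ofReal (p g w) * h (snoc g w)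

theorem measurable_transition (hp : IsTransitionKernel p) {h : Hist G → ENNReal}
    (hh : Measurable h) : Measurable (transition p h) :=
  Finset.measurable_fun_sum _ fun g _ =>
    ((hp.measurable g).ennreal_ofReal).mul (hh.comp (measurable_snoc_left g))

variable [MeasurableSingletonClass G]

/-- Compatibility says that the joint law of the state at time `m` and the past is obtained by
integrating the kernel over the law of the past. -/
theorem isCompatible_iff (hp : IsTransitionKernel p) {μ : Measure (ℤ → G)} :
    IsCompatible p μ ↔ IsProbabilityMeasure μ ∧ ∀ (m : ℤ) (g : G) (B : Set (Hist G)),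
      MeasurableSet B → μ ({x | x m = g} ∩ past m ⁻¹' B) =
        ∫⁻ x in past m ⁻¹' B, ENNReal.ofReal (p g (past m x)) ∂μ := by
  have hle : ∀ m : ℤ, MeasurableSpace.comap (past m : (ℤ → G) → Hist G) inferInstance ≤
      MeasurableSpace.pi := fun m => (measurable_past m).comap_le
  have hA : ∀ (m : ℤ) (g : G), MeasurableSet {x : ℤ → G | x m = g} :=
    measurableSet_eval_eq
  have hset : ∀ (m : ℤ) (g : G) (B : Set (Hist G)) (μ : Measure (ℤ → G)), MeasurableSet B →
      IsProbabilityMeasure μ →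
      (∫ x in past m ⁻¹' B, {x : ℤ → G | x m = g}.indicator (fun _ => (1 : ℝ)) x ∂μ) =
        μ.real ({x | x m = g} ∩ past m ⁻¹' B) := by
    intro m g B μ hB _
    rw [setIntegral_indicator (hA m g)]
    simp [inter_comm, measureReal_restrict_apply]
  have hint : ∀ (m : ℤ) (g : G) (B : Set (Hist G)) (μ : Measure (ℤ → G)),
      IsProbabilityMeasure μ → ENNReal.ofReal (∫ x in past m ⁻¹' B, p g (past m x) ∂μ) =
        ∫⁻ x in past m ⁻¹' B, ENNReal.ofReal (p g (past m x)) ∂μ := by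
    intro m g B μ _
    exact ofReal_integral_eq_lintegral_ofReal (hp.integrable_past μ m g).integrableOn
      (Eventually.of_forall fun x => hp.nonneg g _)
  constructor
  · rintro ⟨hμ, hc⟩
    refine ⟨hμ, fun m g B hB => ?_⟩
    rw [← hint m g B μ hμ, ← setIntegral_congr_ae (f := μ⟦{x : ℤ → G | x m = g} |
      MeasurableSpace.comap (past m) inferInstance⟧) (measurable_past m hB)
      ((hc m g).mono fun x hx _ => hx), setIntegral_condExp (hle m) _ ⟨B, hB, rfl⟩,
      hset m g B μ hB hμ, ofReal_measureReal]
    exact (integrable_const _).indicator (hA m g)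
  · rintro ⟨hμ, hc⟩
    refine ⟨hμ, fun m g => Filter.EventuallyEq.symm ?_⟩
    refine ae_eq_condExp_of_forall_setIntegral_eq (hle m)
      ((integrable_const _).indicator (hA m g)) (fun s _ _ =>
        (hp.integrable_past μ m g).integrableOn) ?_ ?_
    · rintro s ⟨B, hB, rfl⟩ -
      rw [hset m g B μ hB hμ, measureReal_def, hc m g B hB, ← hint m g B μ hμ,
        ENNReal.toReal_ofReal (integral_nonneg fun x => hp.nonneg g _)]
    · exact (((hp.measurable g).comp (comap_measurable (past m))).stronglyMeasurable
        ).aestronglyMeasurable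

theorem IsCompatible.ae_ne_zero (hp : IsTransitionKernel p) {ν : Measure (ℤ → G)}
    (hν : IsCompatible p ν) (m : ℤ) : ∀ᵐ x ∂ν, p (x m) (past m x) ≠ 0 := by
  have h1 : ∀ g, ∀ᵐ x ∂ν, ¬ (x m = g ∧ p g (past m x) = 0) := by
    intro g
    have hB : MeasurableSet {w | p g w = 0} := hp.measurable g (measurableSet_singleton 0)
    rw [ae_iff]
    simp only [not_not]
    refine (((isCompatible_iff hp).1 hν).2 m g _ hB).trans ?_
    refine setLIntegral_eq_zero (measurable_past m hB) fun x hx => ?_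
    have : p g (past m x) = 0 := hx
    simp [this]
  filter_upwards [ae_all_iff.2 h1] with x hx h0
  exact hx (x m) ⟨rfl, h0⟩

theorem IsCompatible.ae_past_mem (hp : IsTransitionKernel p) {ν : Measure (ℤ → G)}
    (hν : IsCompatible p ν) (m : ℤ) : ∀ᵐ x ∂ν, past m x ∈ admissible p := by
  have h1 : ∀ᵐ x ∂ν, ∀ k, p (x k) (past k x) ≠ 0 := ae_all_iff.2 fun k => hν.ae_ne_zero hp k
  filter_upwards [h1] with x hx n
  induction n generalizing m with
  | zero => exact id
  | succ n ih =>
    have h2 : past m x = snoc (x (m - 1)) (past (m - 1) x) := by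
      rw [← past_succ, sub_add_cancel]
    rw [h2, word_snoc]
    rintro (h | h)
    · exact ih (m - 1) h
    · exact hx (m - 1) (h _ (by rw [word_length]))

theorem IsCompatible.lintegral_past_succ (hp : IsTransitionKernel p) {ν : Measure (ℤ → G)}
    (hν : IsCompatible p ν) (m : ℤ) {h : Hist G → ENNReal} (hh : Measurable h) :
    ∫⁻ x, h (past (m + 1) x) ∂ν = ∫⁻ x, transition p h (past m x) ∂ν := by
  have hpm : ∀ g, Measurable fun w => ENNReal.ofReal (p g w) :=
    fun g => (hp.measurable g).ennreal_ofReal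
  have hA : ∀ g : G, MeasurableSet {x : ℤ → G | x m = g} :=
    measurableSet_eval_eq m
  have hs : ∀ g, Measurable fun w => h (snoc g w) := fun g => hh.comp (measurable_snoc_left g)
  have key : ∀ g, (ν.restrict {x | x m = g}).map (past m) =
      (ν.map (past m)).withDensity fun w => ENNReal.ofReal (p g w) := by
    intro g
    ext B hB
    rw [Measure.map_apply (measurable_past m) hB, withDensity_apply _ hB,
      Measure.restrict_apply (measurable_past m hB), inter_comm,
      ((isCompatible_iff hp).1 hν).2 m g B hB,
      setLIntegral_map hB (hpm g) (measurable_past m)]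
  have h1 : ∀ x : ℤ → G, h (past (m + 1) x) =
      ∑ g, {x : ℤ → G | x m = g}.indicator (fun x => h (snoc g (past m x))) x := by
    intro x
    rw [Finset.sum_eq_single (x m) (fun g _ hg => indicator_of_notMem (fun h => hg h.symm) _)
      (by simp), indicator_of_mem (show x ∈ {y : ℤ → G | y m = x m} from rfl), past_succ]
  simp only [h1, transition]
  have hm1 : ∀ g, Measurable fun x : ℤ → G => h (snoc g (past m x)) := fun g =>
    (hs g).comp (measurable_past m)
  have hm2 : ∀ g, Measurable fun x : ℤ → G =>
      ENNReal.ofReal (p g (past m x)) * h (snoc g (past m x)) := fun g =>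
    ((hpm g).mul (hs g)).comp (measurable_past m)
  rw [lintegral_finsetSum _ fun g _ => (hm1 g).indicator (hA g),
    lintegral_finsetSum _ fun g _ => hm2 g]
  refine Finset.sum_congr rfl fun g _ => ?_
  rw [lintegral_indicator (hA g), ← lintegral_map (hs g) (measurable_past m), key,
    lintegral_withDensity_eq_lintegral_mul _ (hpm g) (hs g),
    lintegral_map ((hpm g).mul (hs g)) (measurable_past m)]
  rfl

variable {F : Cube G → Hist G → G}

theorem IsLocalCoupling.lintegral_traj_succ (hF : IsLocalCoupling p F)
    (n : ℕ) {w : Hist G} (hw : w ∈ admissible p) {h : Hist G → ENNReal} (hh : Measurable h) :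
    ∫⁻ u, h (traj F u (n + 1) w) ∂(iidLaw G ℕ) =
      ∫⁻ u, transition p h (traj F u n w) ∂(iidLaw G ℕ) := by
  have hm := hh.comp (hF.measurable_traj (n + 1) hw)
  refine (measurePreserving_snoc.lintegral_comp hm).symm.trans
    ((lintegral_prod _ (hm.comp measurePreserving_snoc.measurable).aemeasurable).trans ?_)
  refine lintegral_congr fun v => ?_
  have hmem := hF.traj_mem v n hw
  set w' := traj F v n w with hw'
  have hFm : Measurable fun a => F a w' :=
    measurable_to_countable' fun g => (hF.reproduces w' hmem g).1
  have h1 : ∀ a, h (traj F (snoc a v) (n + 1) w) = h (snoc (F a w') w') := by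
    intro a
    rw [traj_succ_left]
    rfl
  simp only [Function.comp_apply, h1]
  rw [← lintegral_map (f := fun g => h (snoc g w')) (Measurable.of_discrete) hFm, lintegral_fintype]
  refine Finset.sum_congr rfl fun g _ => ?_
  rw [Measure.map_apply hFm (measurableSet_singleton g), mul_comm]
  congr 1
  exact (hF.reproduces w' hmem g).2

/-- A compatible process run for `n` steps after time `m` has the law of the trajectory of `F`
started from its past at time `m`. -/
theorem IsCompatible.lintegral_past_add (hp : IsTransitionKernel p) (hF : IsLocalCoupling p F)
    {ν : Measure (ℤ → G)} (hν : IsCompatible p ν) (m : ℤ) (n : ℕ) {h : Hist G → ENNReal}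
    (hh : Measurable h) : ∫⁻ x, h (past (m + n) x) ∂ν =
      ∫⁻ x, ∫⁻ u, h (traj F u n (past m x)) ∂(iidLaw G ℕ) ∂ν := by
  induction n generalizing h with
  | zero => simp [traj]
  | succ n ih =>
    rw [Nat.cast_succ, ← add_assoc, hν.lintegral_past_succ hp _ hh,
      ih (measurable_transition hp hh)]
    refine lintegral_congr_ae ?_
    filter_upwards [hν.ae_past_mem hp m] with x hx
    exact (hF.lintegral_traj_succ n hx hh).symm

variable {τ : (ℕ → Cube G) → WithTop ℕ} {g₀ : Hist G}

/-- A compatible process started far in the past has coalesced with the simulated one, so that the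
law of its past agrees with that of the simulated past on events that concern finitely many
letters. -/
theorem IsCompatible.measure_past_le (hp : IsTransitionKernel p) (hF : IsLocalCoupling p F)
    (hτ : IsBackwardCoalescenceTime p F τ) (hg₀ : g₀ ∈ admissible p) {ν : Measure (ℤ → G)}
    (hν : IsCompatible p ν) (m : ℤ) {K : ℕ} {B : Set (Hist G)} (hB : MeasurableSet B)
    (hBK : ∀ w z, word w K = word z K → (w ∈ B → z ∈ B)) :
    ν (past m ⁻¹' B) ≤ iidLaw G ℕ (simHist F τ g₀ ⁻¹' B) := by
  have := hν.prob
  -- the event that the last `K` states have coalesced within `n` steps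
  let W : ℕ → Set (ℕ → Cube G) := fun n => {v | ∀ j < K, τ (fun i => v (i + j)) ≤ n}
  have hWm : ∀ n, MeasurableSet (W n) := by
    intro n
    rw [show W n = ⋂ j, ⋂ (_ : j < K), (fun v i => v (i + j)) ⁻¹' {v | τ v ≤ n} by ext; simp [W]]
    exact MeasurableSet.iInter fun j => MeasurableSet.iInter fun _ =>
      (measurePreserving_shift j).measurable (hτ.measurableSet_le n)
  have hlim : Tendsto (fun n => iidLaw G ℕ (W n)ᶜ) atTop (nhds 0) := by
    have h0 : iidLaw G ℕ (⋂ n, (W n)ᶜ) = 0 := by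
      refine measure_mono_null ?_ hτ.ae_shift_ne_top
      intro v hv hcon
      obtain ⟨l, hl⟩ := exists_natCast_ge hcon K
      exact mem_iInter.1 hv l hl
    rw [← h0]
    refine tendsto_measure_iInter_atTop (fun n => (hWm n).compl.nullMeasurableSet)
      (fun i j hij => compl_subset_compl.2 fun v hv k hk => (hv k hk).trans ?_)
      ⟨0, measure_ne_top _ _⟩
    exact_mod_cast hij
  have hbound : ∀ n, ν (past m ⁻¹' B) ≤
      iidLaw G ℕ (simHist F τ g₀ ⁻¹' B) + iidLaw G ℕ (W n)ᶜ := by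
    intro n
    have h1 := hν.lintegral_past_add hp hF (m - (n + K : ℕ)) (n + K)
      (h := B.indicator 1) (measurable_one.indicator hB)
    rw [sub_add_cancel] at h1
    have h2 : ν (past m ⁻¹' B) = ∫⁻ x, B.indicator 1 (past m x) ∂ν := by
      rw [← lintegral_indicator_one (measurable_past m hB)]
      rfl
    rw [h2, h1]
    calc _ ≤ ∫⁻ _, (iidLaw G ℕ (simHist F τ g₀ ⁻¹' B) + iidLaw G ℕ (W n)ᶜ) ∂ν := by
          refine lintegral_mono_ae ?_
          filter_upwards [hν.ae_past_mem hp (m - (n + K : ℕ))] with x hx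
          have h3 : ∫⁻ u, B.indicator (1 : Hist G → ENNReal)
              (traj F u (n + K) (past (m - (n + K : ℕ)) x)) ∂(iidLaw G ℕ) =
              iidLaw G ℕ ((fun u => traj F u (n + K) (past (m - (n + K : ℕ)) x)) ⁻¹' B) := by
            rw [← lintegral_indicator_one (hF.measurable_traj (n + K) hx hB)]
            rfl
          rw [h3]
          refine (measure_mono ?_).trans (measure_union_le _ _)
          intro u hu
          by_cases huW : u ∈ W n
          · exact Or.inl (hBK _ _ (hτ.traj_eq_simHist hF hg₀ huW le_rfl hx) hu)
          · exact Or.inr huW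
      _ = _ := by simp
  have := hlim.const_add (iidLaw G ℕ (simHist F τ g₀ ⁻¹' B))
  rw [add_zero] at this
  exact ge_of_tendsto' this hbound

theorem IsCompatible.measure_past_eq (hp : IsTransitionKernel p) (hF : IsLocalCoupling p F)
    (hτ : IsBackwardCoalescenceTime p F τ) (hg₀ : g₀ ∈ admissible p) {ν : Measure (ℤ → G)}
    (hν : IsCompatible p ν) (m : ℤ) {K : ℕ} {B : Set (Hist G)} (hB : MeasurableSet B)
    (hBK : ∀ w z, word w K = word z K → (w ∈ B → z ∈ B)) :
    ν (past m ⁻¹' B) = iidLaw G ℕ (simHist F τ g₀ ⁻¹' B) := by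
  have := hν.prob
  refine le_antisymm (hν.measure_past_le hp hF hτ hg₀ m hB hBK) ?_
  have h1 := hν.measure_past_le hp hF hτ hg₀ m hB.compl
    (fun w z h hw hz => hw (hBK z w h.symm hz))
  rw [preimage_compl, preimage_compl, prob_compl_eq_one_sub (measurable_past m hB),
    prob_compl_eq_one_sub (hτ.measurable_simHist hF hg₀ hB)] at h1
  exact (ENNReal.sub_le_sub_iff_left prob_le_one ENNReal.one_ne_top).1 h1

theorem IsCompatible.unique (hp : IsTransitionKernel p) (hF : IsLocalCoupling p F)
    (hτ : IsBackwardCoalescenceTime p F τ) (hg₀ : g₀ ∈ admissible p) {ν ν' : Measure (ℤ → G)}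
    (hν : IsCompatible p ν) (hν' : IsCompatible p ν') : ν = ν' := by
  have := hν.prob
  have := hν'.prob
  refine IsProjectiveLimit.unique (P := fun I : Finset ℤ => ν.map I.restrict) (fun I => rfl)
    fun I => ?_
  obtain ⟨m, hm⟩ : ∃ m : ℤ, ∀ i ∈ I, i < m := by
    obtain ⟨M, hM⟩ := I.finite_toSet.bddAbove
    exact ⟨M + 1, fun i hi => Int.lt_add_one_of_le (hM hi)⟩
  let r : Hist G → (I → G) := fun w i => w (m - 1 - i).toNat
  have hr : Measurable r := measurable_pi_lambda _ fun i => measurable_pi_apply _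
  have hrI : (I.restrict : (ℤ → G) → I → G) = r ∘ past m := by
    funext x i
    have := hm i i.2
    simp only [Finset.restrict, r, Function.comp_apply, past]
    congr 1
    omega
  ext S hS
  rw [Measure.map_apply (by fun_prop) hS, Measure.map_apply (by fun_prop) hS, hrI,
    preimage_comp]
  have hK : ∀ w z : Hist G, word w (∑ i : I, ((m - 1 - i).toNat + 1)) =
      word z (∑ i : I, ((m - 1 - i).toNat + 1)) → (w ∈ r ⁻¹' S → z ∈ r ⁻¹' S) := by
    intro w z h
    have : r w = r z := by
      funext i
      refine word_eq_word_iff.1 h _ (Nat.lt_of_succ_le ?_)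
      exact Finset.single_le_sum (f := fun i : I => (m - 1 - i).toNat + 1)
        (fun _ _ => Nat.zero_le _) (Finset.mem_univ i)
    rw [mem_preimage, mem_preimage, this]
    exact id
  rw [hν.measure_past_eq hp hF hτ hg₀ m (hr hS) hK, hν'.measure_past_eq hp hF hτ hg₀ m (hr hS) hK]

/-- The variable used at time `m` is independent of the simulated past, which is admissible, and
`F` reproduces the kernel. -/
theorem IsBackwardCoalescenceTime.isCompatible (hτ : IsBackwardCoalescenceTime p F τ)
    (hp : IsTransitionKernel p) (hF : IsLocalCoupling p F)
    (h_lim : ∀ r < 1, ∃ k, 1 ≤ k ∧ r < aMin p k) (hg₀ : g₀ ∈ admissible p) :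
    IsCompatible p ((iidLaw G ℤ).map (simulated F τ g₀)) := by
  have hX := hτ.measurable_simulated hF hg₀
  have hS := hτ.measurable_simState hF hg₀
  have hH := hτ.measurable_simHist hF hg₀
  refine (isCompatible_iff hp).2 ⟨Measure.isProbabilityMeasure_map hX.aemeasurable,
    fun m g B hB => ?_⟩
  have hA : MeasurableSet {x : ℤ → G | x m = g} :=
    measurableSet_eval_eq m g
  have hpm : Measurable fun w => ENNReal.ofReal (p g w) := (hp.measurable g).ennreal_ofReal
  -- the left-hand side, expressed with the variables at times `≤ m`
  let T : Set (ℕ → Cube G) := {v | simState F τ g₀ v = g ∧ simHist F τ g₀ (fun i => v (i + 1)) ∈ B}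
  have hT : MeasurableSet T := (hS (measurableSet_singleton g)).inter
    ((hH.comp (measurePreserving_shift 1).measurable) hB)
  have hleft : simulated F τ g₀ ⁻¹' ({x | x m = g} ∩ past m ⁻¹' B) =
      (fun (u : ℤ → Cube G) (i : ℕ) => u (m - i)) ⁻¹' T := by
    ext u
    have h1 : (fun i : ℕ => u (m - ((i + 1 : ℕ) : ℤ))) = fun i : ℕ => u (m - 1 - i) := by
      funext i
      congr 1
      push_cast
      ring
    simp only [mem_preimage, mem_inter_iff, mem_ofPred_eq, past_simulated, T, h1]
    rfl
  rw [Measure.map_apply hX (hA.inter (measurable_past m hB)), hleft,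
    (measurePreserving_back m).measure_preimage hT.nullMeasurableSet,
    ← measurePreserving_snoc.measure_preimage hT.nullMeasurableSet,
    Measure.prod_apply (measurePreserving_snoc.measurable hT)]
  -- the right-hand side is an integral over the variables at times `< m`
  have hright : ∫⁻ x in past m ⁻¹' B, ENNReal.ofReal (p g (past m x))
      ∂((iidLaw G ℤ).map (simulated F τ g₀)) =
      ∫⁻ v, (simHist F τ g₀ ⁻¹' B).indicator
        (fun v => ENNReal.ofReal (p g (simHist F τ g₀ v))) v ∂(iidLaw G ℕ) := by
    have hm1 : Measurable fun x : ℤ → G => ENNReal.ofReal (p g (past m x)) :=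
      hpm.comp (measurable_past m)
    have hm2 : Measurable fun v => ENNReal.ofReal (p g (simHist F τ g₀ v)) := hpm.comp hH
    rw [lintegral_indicator (hH hB), setLIntegral_map (measurable_past m hB) hm1 hX,
      ← (measurePreserving_back (m - 1)).setLIntegral_comp_preimage (hH hB) hm2]
    have h2 : simulated F τ g₀ ⁻¹' (past m ⁻¹' B) =
        (fun (u : ℤ → Cube G) (i : ℕ) => u (m - 1 - i)) ⁻¹' (simHist F τ g₀ ⁻¹' B) := by
      ext u
      simp only [mem_preimage, past_simulated]
    simp only [h2, past_simulated]
  rw [hright]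
  refine lintegral_congr_ae ?_
  have hn := measurePreserving_snoc.quasiMeasurePreserving.ae hτ.ae_shift_ne_top
  filter_upwards [Measure.ae_ae_of_ae_prod hn, hτ.ae_shift_ne_top] with v hv hv'
  have hmem := hτ.simHist_mem hF hg₀ hv'
  have hstate : ∀ᵐ a ∂(cubeLaw G), simState F τ g₀ (snoc a v) = F a (simHist F τ g₀ v) := by
    filter_upwards [hv] with a ha
    exact hτ.simState_eq hF h_lim hg₀ ha
  by_cases hvB : simHist F τ g₀ v ∈ B
  · rw [indicator_of_mem (show v ∈ simHist F τ g₀ ⁻¹' B from hvB),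
      ← (hF.reproduces _ hmem g).2]
    refine measure_congr ?_
    filter_upwards [hstate] with a ha
    refine propext ?_
    change (simState F τ g₀ (snoc a v) = g ∧ simHist F τ g₀ v ∈ B) ↔ F a (simHist F τ g₀ v) = g
    rw [ha]
    exact and_iff_left hvB
  · rw [indicator_of_notMem (show v ∉ simHist F τ g₀ ⁻¹' B from hvB)]
    convert measure_empty (μ := cubeLaw G)
    exact eq_empty_of_forall_notMem fun a ha => hvB ha.2

end Compatible

/-! ### Arcs and coefficients -/

section Arcs

variable {G : Type*} {p : G → Hist G → ℝ}

theorem arc_iff {w : Hist G} (hw : w ∈ admissible p) (g : G) :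
    arc p (w 0) g ↔ 0 < aLetter p 1 g w := by
  constructor
  · rintro ⟨z, -, h0, hz⟩
    rwa [← aLetter_congr (word_one_eq_iff.2 h0)]
  · exact fun h => ⟨w, hw, rfl, h⟩

theorem IsGeneralizedRandomWalk.admissible_subset {A : G → G → Prop}
    (hA : IsGeneralizedRandomWalk p A) : admissible p ⊆ backwardPaths A := by
  intro w hw k
  obtain ⟨z, hz, hne⟩ := exists_ne_zero_of_mem_admissible hw k
  by_contra hcon
  exact hne (hA.eq_zero _ _ hcon z hz)

/-- On the letters that occur in admissible histories, a graph on which `p` is a generalized random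
walk has the same arcs as the graph of `p`. -/
theorem IsGeneralizedRandomWalk.iff_aLetter_pos [Fintype G] [MeasurableSpace G]
    (hp : IsTransitionKernel p) {A : G → G → Prop} (hA : IsGeneralizedRandomWalk p A)
    {w : Hist G} (hw : w ∈ admissible p) (g : G) : A (w 0) g ↔ 0 < aLetter p 1 g w := by
  constructor
  · intro h
    obtain ⟨ε, hε, hlow⟩ := hA.lower_bound _ _ h
    refine hε.trans_le (le_csInf ⟨_, w, ⟨hw, rfl⟩, rfl⟩ ?_)
    rintro _ ⟨z, ⟨hz, hz0⟩, rfl⟩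
    exact (hlow z (hA.admissible_subset hz) (word_one_eq_iff.1 hz0)).le
  · intro h
    by_contra hcon
    have := h.trans_le (aLetter_le hp 1 g hw)
    exact this.ne' (hA.eq_zero _ _ hcon w rfl)

end Arcs

end PerfectSim

theorem mainTheorem3 {G : Type*} [Fintype G] [MeasurableSpace G] [MeasurableSingletonClass G]
    (p : G → Hist G → ℝ) (hp : IsTransitionKernel p)
    -- the graph: that of the kernel, or one on which `p` is a generalized random walk
    (A : G → G → Prop) (hA : A = arc p ∨ IsGeneralizedRandomWalk p A)
    (h_div : Tendsto (fun N : ℕ => ∑ n ∈ Finset.Icc 1 N, ∏ m ∈ Finset.Icc 1 n, aMin p m)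
      atTop atTop)
    -- the graph has a single irreducible class, and this class is aperiodic
    (h_class : ∃ C : Set G, IsIrreducibleClass A C ∧
      (∀ C' : Set G, IsIrreducibleClass A C' → C' = C) ∧ IsAperiodic A C)
    (h_non : ∀ g, ∃ w, ¬ A w g) :
    (∃ f fbar : ℝ → Hist G → G, IsMaximalCoupling p f ∧ IsRearrangement p f fbar) ∧
    ∀ f fbar : ℝ → Hist G → G, IsMaximalCoupling p f → IsRearrangement p f fbar →
      Reproduces p (fhat p fbar) ∧
      ∃ τ : (ℕ → Cube G) → WithTop ℕ,
        IsBackwardCoalescenceTime p (fhat p fbar) τ ∧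
        ∀ g₀ ∈ admissible p,
          IsStationaryLaw ((iidLaw G ℤ).map (simulated (fhat p fbar) τ g₀)) ∧
          IsCompatible p ((iidLaw G ℤ).map (simulated (fhat p fbar) τ g₀)) ∧
          ∀ ν : Measure (ℤ → G), IsCompatible p ν →
            ν = (iidLaw G ℤ).map (simulated (fhat p fbar) τ g₀) := by
  obtain ⟨C, hC, huniq, haper⟩ := h_class
  have : Nonempty G := hC.1.nonempty
  have h_lim : ∀ r < 1, ∃ k, 1 ≤ k ∧ r < aMin p k := fun r hr => exists_lt_aMin hp h_div hr
  have h_pos := aMin_one_pos hp h_div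
  have hA' : ∀ w ∈ admissible p, ∀ g, A (w 0) g ↔ 0 < aLetter p 1 g w := by
    intro w hw g
    rcases hA with rfl | hA
    · exact arc_iff hw g
    · exact hA.iff_aLetter_pos hp hw g
  refine ⟨?_, fun f fbar hf hfbar => ?_⟩
  · obtain ⟨f, hf⟩ := exists_isMaximalCoupling hp
    obtain ⟨fbar, hfbar⟩ := exists_isRearrangement hp h_pos f
    exact ⟨f, fbar, hf, hfbar⟩
  · have hF := isLocalCoupling_fhat hp h_lim h_pos hf hfbar
    obtain ⟨N, hN, D, hD, hD0, hcoal⟩ := hF.exists_block hp h_pos hA' hC huniq haper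
    have hτ := hF.isBackwardCoalescenceTime hp h_div hN hD hD0 hcoal
    refine ⟨hF.reproduces, _, hτ, fun g₀ hg₀ => ?_⟩
    have hX := hτ.isCompatible hp hF h_lim hg₀
    exact ⟨hτ.isStationaryLaw hF hg₀, hX, fun ν hν => hν.unique hp hF hτ hg₀ hX⟩
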